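/- Let $H$ be a separable real Hilbert space with norm $|\cdot|$, let $m$ be a centered nondegenerate Gaussian measure on $H$ with covariance operator $Q$ (nondegenerate meaning $\ker Q=\{0\}$), and let $A:=-\tfrac12 Q^{-1}$. For $s>0$ let $$e^{sA}=\sum_{\lambda} e^{-s/(2\lambda)}\,\Pi_\lambda ,$$ the sum running over the eigenvalues $\lambda$ of $Q$, with $\Pi_\lambda$ the orthogonal projection onto the corresponding eigenspace, and for $t>0$ let $Q_t:=\int_0^t e^{2As}\,ds=Q(1-e^{2At})$. Write $N_{Q_t}$ for the Gaussian measure on $H$ with mean $0$ and covariance operator $Q_t$, and define the Mehler semigroup by $$P_tg(x):=\int_H g(e^{tA}x+y)\,dN_{Q_t}(y),\qquad x\in H,\ t>0.$$ For $1<p<\infty$ let $W^{1,p}(H,m)$ be the closure of the smooth cylindrical functions (functions $u(x)=\varphi(\langle v_1,x\rangle,\dots,\langle v_n,x\rangle)$ with $v_i\in H$ and $\varphi\in C^\infty_b(\mathbb{R}^n)$, i.e. smooth and bounded together with all its derivatives) with respect to the norm $\|u\|_{L^p(m)}+\|\nabla u\|_{L^p(m)}$; for $f\in W^{1,p}(H,m)$,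 $\nabla f\in L^p(H,m;H)$ denotes the $L^p$-limit of the gradients $\nabla u_n$ along smooth cylindrical $u_n\to f$ in $L^p(m)$ whose gradients converge in $L^p(m;H)$. Let $p\in(1,\infty)$, $f\in W^{1,p}(H,m)$ and $t>0$. Then $P_tf$ and $P_t|\nabla f|$ are well defined at every point of $H$, for any choice of representatives of $f$ and $\nabla f$: the series for $e^{sA}$ converges unconditionally in operator norm for every $s>0$, the Gaussian measure $N_{Q_t}$ exists, and $y\mapsto f(e^{tA}x+y)$ and $y\mapsto|\nabla f|(e^{tA}x+y)$ are $N_{Q_t}$-integrable for every $x\in H$. Moreover, for all $x_0,x_1\in H$, $$|P_tf(x_0)-P_tf(x_1)|\le |x_1-x_0|\exp\left(\frac{|x_1-x_0|^2}{4t}\right)\bigl(P_t|\nabla f|(x_0)+P_t|\nabla f|(x_1)\bigr).$$ -/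

import Mathlib

open MeasureTheory ProbabilityTheory Filter Topology
open scoped ENNReal ContDiff InnerProductSpace

noncomputable section

variable {H : Type*} [NormedAddCommGroup H] [InnerProductSpace ℝ H] [CompleteSpace H]

/-- The orthogonal projection of `H` onto the (closed) eigenspace `{v | Q v = μ v}` of a bounded
operator `Q`. -/
def eigenProj (Q : H →L[ℝ] H) (μ : ℝ) : H →L[ℝ] H :=
  (Q - μ • ContinuousLinearMap.id ℝ H).ker.starProjection

/-- The operator `e^{sA}`, `s > 0`, where `A = -(1/2) Q⁻¹` and `Q` is an injective, compact,
nonnegative self-adjoint operator. If `Q v = μ v` then `A v = -(1 / (2 μ)) v`, so `e^{sA}` is given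
by its spectral decomposition `∑ μ, exp (-s / (2 μ)) • (projection on the μ-eigenspace of Q)`. The
terms vanish unless `μ` is an eigenvalue of `Q`; for `s > 0` the series converges unconditionally
in operator norm, because the eigenvalues are positive and accumulate at most at `0`. -/
def expA (Q : H →L[ℝ] H) (s : ℝ) : H →L[ℝ] H :=
  ∑' μ : ℝ, Real.exp (-s / (2 * μ)) • eigenProj Q μ

/-- The operator `Q_t = ∫₀ᵗ e^{2As} ds = Q (1 - e^{2At})`. -/
def covAt (Q : H →L[ℝ] H) (t : ℝ) : H →L[ℝ] H :=
  Q ∘L (ContinuousLinearMap.id ℝ H - expA Q (2 * t))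

variable [MeasurableSpace H] [BorelSpace H]

/-- `μ` is a Gaussian measure with mean `a` and covariance operator `C`. -/
def IsGaussianWith (a : H) (C : H →L[ℝ] H) (μ : Measure H) : Prop :=
  IsGaussian μ ∧ ∫ x, x ∂μ = a ∧ ∀ x y : H, covarianceBilin μ x y = ⟪C x, y⟫_ℝ

open Classical in
/-- The Gaussian measure `N_{a,C}` with mean `a` and covariance operator `C`. -/
def gaussianN (a : H) (C : H →L[ℝ] H) : Measure H :=
  if h : ∃ μ : Measure H, IsGaussianWith a C μ then h.choose else 0

/-- The semigroup given by Mehler's formula `P_t f (x) = ∫ f (e^{At} x + y) dN_{0,Q_t}(y)`. -/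
def mehlerP (Q : H →L[ℝ] H) (t : ℝ) (f : H → ℝ) (x : H) : ℝ :=
  ∫ y, f (expA Q t x + y) ∂(gaussianN 0 (covAt Q t))

/-- Smooth cylindrical functions: `u x = φ (⟪v₁, x⟫, …, ⟪vₙ, x⟫)` with `φ` of class `C_b^∞`. -/
def IsSmoothCylindrical (u : H → ℝ) : Prop :=
  ∃ (n : ℕ) (v : Fin n → H) (φ : (Fin n → ℝ) → ℝ),
    ContDiff ℝ ∞ φ ∧ (∀ k : ℕ, ∃ C : ℝ, ∀ z, ‖iteratedFDeriv ℝ k φ z‖ ≤ C) ∧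
      ∀ x, u x = φ (fun i => ⟪v i, x⟫_ℝ)

/-- `f` belongs to `W^{1,p}(H, m)`, the closure of the smooth cylindrical functions with respect to
`‖u‖_{L^p} + ‖∇u‖_{L^p}`, and `G` is (a version of) its gradient: some sequence of smooth
cylindrical functions converges to `f` in `L^p(m)` with gradients converging to `G` in
`L^p(m; H)`. -/
def HasSobolevGradient (p : ℝ≥0∞) (m : Measure H) (f : H → ℝ) (G : H → H) : Prop :=
  MemLp f p m ∧ MemLp G p m ∧
    ∃ u : ℕ → H → ℝ, (∀ n, IsSmoothCylindrical (u n)) ∧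
      Tendsto (fun n => eLpNorm (fun x => u n x - f x) p m) atTop (𝓝 0) ∧
      Tendsto (fun n => eLpNorm (fun x => gradient (u n) x - G x) p m) atTop (𝓝 0)

end

/-!
Write `Q` for the covariance operator of `m`, and `μ_x` for the law of `e^{tA} x + y` when `y` has
law `N_{Q_t}`, so that `P_t g (x) = ∫ g dμ_x`.

`Q` is compact and of trace class, because it is the Bochner integral of the rank one operators
`x ⊗ x` and `‖x‖²` is `m`-integrable. Hence `φ(Q)` is an absolutely convergent series whenever
`|φ(l)| ≤ C l` on `l > 0` (`IsPosTraceClass.summable_smul_eigenProj`). This covers `e^{sA}`, the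
perturbation `1 - (1 - e^{2tA})^{1/2}` of the identity, and `Q_t⁻¹ e^{tA}`. Identities between such
operators are verified on a Hilbert basis of eigenvectors. In particular `N_{Q_t}` exists: it is the
image of `m` under `(1 - e^{2tA})^{1/2}`.

Two comparisons of measures carry the argument.

* The measure `μ_x` is at most `C e^{⟪z, ·⟫} m` with `z = Q_t⁻¹ e^{tA} x` (`lintegral_mehler_le`).
  For `x = 0` the measure `N_{Q_t}` arises from `m` by contracting each eigendirection, and
  contracting one direction by `s` costs the factor `s⁻¹` (`map_contraction_le`); the product of
  these factors is at most `e^{tr Q / (2 t)}` (`map_rootOp_le`). The case of general `x` follows by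
  the Cameron–Martin formula (`lintegral_comp_add_eq`), which is elementary here since
  `e^{tA} x = Q_t z` with `z` in `H`. As `e^{⟪z, ·⟫}` is in every `L^q(m)`, Hölder's inequality shows
  that convergence in `L^p(m)` implies convergence in `L^1(μ_x)`
  (`exists_lintegral_mehler_le_eLpNorm`).
* For `0 ≤ r ≤ 1`, `μ_{x + r h} ≤ e^{‖h‖² / (4 t)} (μ_x + μ_{x + h})`
  (`lintegral_mehler_segment_le`). By the Cameron–Martin formula the density of `μ_{x + r h}` with
  respect to `μ_x` is the exponential of a quadratic function of `r` with second derivative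
  `-⟪Q_t⁻¹ e^{tA} h, e^{tA} h⟫`, and this quantity is at least `-‖h‖² / t`.

For a smooth cylindrical `u`, the fundamental theorem of calculus on the segment from `x` to `x + h`,
the bound `‖e^{tA} h‖ ≤ ‖h‖` and the second comparison give the estimate
(`lintegral_enorm_sub_mehler_le`); the first comparison lets it pass to the limit
(`HasSobolevGradient.lintegral_enorm_sub_mehler_le`).
-/

/-! ### Spectral calculus of positive trace class operators -/

section Eigenprojections

universe u

variable {H : Type u} [NormedAddCommGroup H] [InnerProductSpace ℝ H] [CompleteSpace H]

lemma eigenProj_apply_of_eigen {Q : H →L[ℝ] H} {l : ℝ} {v : H} (hv : Q v = l • v) :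
    eigenProj Q l v = v := by
  apply (Submodule.starProjection_eq_self_iff).2
  simp [LinearMap.mem_ker, hv]

lemma apply_eigenProj (Q : H →L[ℝ] H) (l : ℝ) (v : H) :
    Q (eigenProj Q l v) = l • eigenProj Q l v := by
  have h : eigenProj Q l v ∈ (Q - l • ContinuousLinearMap.id ℝ H).ker :=
    Submodule.starProjection_apply_mem (Q - l • ContinuousLinearMap.id ℝ H).ker v
  rw [LinearMap.mem_ker] at h
  simpa [sub_eq_zero] using h

omit [CompleteSpace H] in
lemma inner_eq_zero_of_eigen {Q : H →L[ℝ] H} (hsymm : ∀ x y, ⟪Q x, y⟫_ℝ = ⟪x, Q y⟫_ℝ)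
    {l l' : ℝ} (hne : l ≠ l') {v w : H} (hv : Q v = l • v) (hw : Q w = l' • w) :
    ⟪v, w⟫_ℝ = 0 := by
  have h := hsymm v w
  rw [hv, hw, real_inner_smul_left, real_inner_smul_right] at h
  have : (l - l') * ⟪v, w⟫_ℝ = 0 := by linarith
  exact (mul_eq_zero.1 this).resolve_left (sub_ne_zero.2 hne)

lemma eigenProj_apply_of_eigen_ne {Q : H →L[ℝ] H} (hsymm : ∀ x y, ⟪Q x, y⟫_ℝ = ⟪x, Q y⟫_ℝ)
    {l l' : ℝ} (hne : l' ≠ l) {v : H} (hv : Q v = l • v) : eigenProj Q l' v = 0 := by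
  refine (Submodule.starProjection_apply_eq_zero_iff _).2 fun w hw ↦ ?_
  rw [LinearMap.mem_ker] at hw
  exact inner_eq_zero_of_eigen hsymm hne (by simpa [sub_eq_zero] using hw) hv

/-- A compact, symmetric, strictly positive operator whose trace is at most `K`. The trace bound
is expressed through the finite orthonormal subsets of `H`. -/
structure IsPosTraceClass (Q : H →L[ℝ] H) (K : ℝ) : Prop where
  symm : ∀ x y, ⟪Q x, y⟫_ℝ = ⟪x, Q y⟫_ℝ
  pos : ∀ x, x ≠ 0 → 0 < ⟪Q x, x⟫_ℝ
  compact : IsCompactOperator Q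
  sum_le : ∀ F : Finset H, Orthonormal ℝ ((↑) : F → H) → ∑ v ∈ F, ⟪Q v, v⟫_ℝ ≤ K

/-- The operator `φ(Q) = ∑ μ, φ μ • (projection on the μ-eigenspace of Q)`. -/
noncomputable def spectralSum (Q : H →L[ℝ] H) (φ : ℝ → ℝ) : H →L[ℝ] H :=
  ∑' l : ℝ, φ l • eigenProj Q l

namespace IsPosTraceClass

variable {Q : H →L[ℝ] H} {K : ℝ} (hQ : IsPosTraceClass Q K)
include hQ

omit [CompleteSpace H] in
lemma eigenvalue_pos {l : ℝ} {v : H} (hv : Q v = l • v) (hne : v ≠ 0) : 0 < l := by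
  have h := hQ.pos v hne
  rw [hv, real_inner_smul_left] at h
  exact pos_of_mul_pos_left h real_inner_self_nonneg

omit [CompleteSpace H] in
lemma sum_eigenvalue_le {ι : Type*} {v : ι → H} (hv : Orthonormal ℝ v) {l : ι → ℝ}
    (hl : ∀ i, Q (v i) = l i • v i) (F : Finset ι) : ∑ i ∈ F, l i ≤ K := by
  classical
  have hinj := hv.linearIndependent.injective
  have h := hQ.sum_le (F.image v) (by
    have := hv.toSubtypeRange
    have h2 := this.comp (fun x : (F.image v : Finset H) ↦
      (⟨x.1, by obtain ⟨i, -, hi⟩ := Finset.mem_image.1 x.2; exact ⟨i, hi⟩⟩ : Set.range v))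
      (fun x y hxy ↦ Subtype.ext (congrArg (fun z : Set.range v ↦ (z : H)) hxy))
    exact h2)
  rw [Finset.sum_image fun i _ j _ hij ↦ hinj hij] at h
  refine le_trans (le_of_eq (Finset.sum_congr rfl fun i _ ↦ ?_)) h
  rw [hl, real_inner_smul_left, real_inner_self_eq_norm_sq, hv.1 i]
  simp

omit [CompleteSpace H] in
lemma summable_eigenvalue {ι : Type*} {v : ι → H} (hv : Orthonormal ℝ v) {l : ι → ℝ}
    (hl : ∀ i, Q (v i) = l i • v i) : Summable l :=
  summable_of_sum_le (fun i ↦ (hQ.eigenvalue_pos (hl i) (hv.ne_zero i)).le)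
    (hQ.sum_eigenvalue_le hv hl)

/-- Distinct eigenvalues have orthonormal eigenvectors, so their sum is at most the trace of `Q`;
this makes `φ(Q)` absolutely convergent as soon as `φ μ = O(μ)`. -/
lemma summable_smul_eigenProj {φ : ℝ → ℝ} {C : ℝ} (hφ : ∀ l, 0 < l → |φ l| ≤ C * l) :
    Summable fun l : ℝ ↦ φ l • eigenProj Q l := by
  have hex : ∀ l : {l : ℝ // eigenProj Q l ≠ 0}, ∃ v : H, ‖v‖ = 1 ∧ Q v = l.1 • v := by
    rintro ⟨l, hl⟩
    obtain ⟨x, hx⟩ : ∃ x, eigenProj Q l x ≠ 0 := by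
      by_contra! h
      exact hl (ContinuousLinearMap.ext h)
    refine ⟨‖eigenProj Q l x‖⁻¹ • eigenProj Q l x, ?_, ?_⟩
    · rw [norm_smul, norm_inv, norm_norm, inv_mul_cancel₀ (norm_ne_zero_iff.2 hx)]
    · rw [map_smul, apply_eigenProj, smul_comm]
  choose v hv1 hv2 using hex
  have hortho : Orthonormal ℝ v :=
    ⟨hv1, fun i j hij ↦ inner_eq_zero_of_eigen hQ.symm
      (fun h ↦ hij (Subtype.ext h)) (hv2 i) (hv2 j)⟩
  have hpos : ∀ l : {l : ℝ // eigenProj Q l ≠ 0}, 0 < l.1 := fun l ↦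
    hQ.eigenvalue_pos (hv2 l) (hortho.ne_zero l)
  have hs := hQ.summable_eigenvalue hortho hv2
  refine (Function.Injective.summable_iff (g := ((↑) : {l : ℝ // eigenProj Q l ≠ 0} → ℝ))
    Subtype.val_injective fun l hl ↦ ?_).1 ?_
  · have : eigenProj Q l = 0 := by simpa using hl
    simp [this]
  · refine Summable.of_norm_bounded (hs.mul_left C) fun l ↦ ?_
    rw [Function.comp_apply, norm_smul, Real.norm_eq_abs]
    refine (mul_le_of_le_one_right (abs_nonneg _) ?_).trans (hφ _ (hpos l))
    exact Submodule.starProjection_norm_le _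

lemma spectralSum_apply_of_eigen {φ : ℝ → ℝ} {C : ℝ} (hφ : ∀ l, 0 < l → |φ l| ≤ C * l)
    {l : ℝ} {v : H} (hv : Q v = l • v) : spectralSum Q φ v = φ l • v := by
  have h := (hQ.summable_smul_eigenProj hφ).hasSum.mapL (ContinuousLinearMap.apply ℝ H v)
  refine h.unique ?_
  have h2 := hasSum_single (f := fun l' ↦ ContinuousLinearMap.apply ℝ H v (φ l' • eigenProj Q l')) l
    (fun l' hl' ↦ by simp [eigenProj_apply_of_eigen_ne hQ.symm hl' hv])
  simpa [eigenProj_apply_of_eigen hv] using h2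

/-- The spectral theorem: an orthonormal Hilbert basis of eigenvectors. -/
lemma exists_hilbertBasis_eigen : ∃ (ι : Type u) (b : HilbertBasis ι ℝ H) (l : ι → ℝ),
    ∀ i, Q (b i) = l i • b i := by
  have hsymm : (Q : H →ₗ[ℝ] H).IsSymmetric := hQ.symm
  have hfam := hsymm.orthogonalFamily_eigenspaces
  have hclosed : ∀ l : ℝ, IsClosed (Module.End.eigenspace (Q : Module.End ℝ H) l : Set H) := by
    intro l
    have : (Module.End.eigenspace (Q : Module.End ℝ H) l : Set H) = {v | Q v = l • v} := by
      ext v; simp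
    rw [this]
    exact isClosed_eq (by fun_prop) (by fun_prop)
  have : ∀ l : ℝ, CompleteSpace (Module.End.eigenspace (Q : Module.End ℝ H) l) :=
    fun l ↦ (hclosed l).completeSpace_coe
  choose w b hb using fun l : ℝ ↦
    exists_hilbertBasis ℝ (Module.End.eigenspace (Q : Module.End ℝ H) l)
  have hon := hfam.orthonormal_sigma_orthonormal (v_family := fun l ↦ b l)
    (fun l ↦ (b l).orthonormal)
  refine ⟨Σ l, w l, HilbertBasis.mkOfOrthogonalEqBot hon ?_, fun i ↦ i.1, fun i ↦ ?_⟩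
  · rw [eq_bot_iff, ← ContinuousLinearMap.orthogonalComplement_iSup_eigenspaces_eq_bot hQ.compact
      hsymm, ← Submodule.orthogonal_closure (Submodule.span ℝ _)]
    refine Submodule.orthogonal_le (iSup_le fun l v hv ↦ ?_)
    have h1 := (b l).hasSum_repr ⟨v, hv⟩
    have h2 := h1.mapL (Submodule.subtypeL _)
    refine (Submodule.isClosed_topologicalClosure _).mem_of_tendsto h2 (Eventually.of_forall ?_)
    intro F
    refine Submodule.sum_mem _ fun i _ ↦ ?_
    rw [map_smul]
    exact Submodule.smul_mem _ _ (Submodule.le_topologicalClosure _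
      (Submodule.subset_span ⟨⟨l, i⟩, rfl⟩))
  · rw [HilbertBasis.coe_mkOfOrthogonalEqBot]
    simpa using Module.End.mem_eigenspace_iff.1 (b i.1 i.2).2

end IsPosTraceClass

end Eigenprojections

/-! ### Operators that are diagonal in a Hilbert basis -/

section Diagonal

variable {H : Type*} [NormedAddCommGroup H] [InnerProductSpace ℝ H] [CompleteSpace H]
  {ι : Type*} (b : HilbertBasis ι ℝ H)
include b

omit [CompleteSpace H] in
lemma HilbertBasis.clm_ext {A B : H →L[ℝ] H} (h : ∀ i, A (b i) = B (b i)) : A = B :=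
  ContinuousLinearMap.ext_on (by
    rw [dense_iff_closure_eq, ← Submodule.topologicalClosure_coe, b.dense_span]; rfl)
    (by rintro _ ⟨i, rfl⟩; exact h i)

omit [CompleteSpace H] in
lemma HilbertBasis.inner_apply_of_diagonal {A : H →L[ℝ] H} {α : ι → ℝ}
    (hA : ∀ i, A (b i) = α i • b i) (i : ι) (x : H) : ⟪b i, A x⟫_ℝ = α i * ⟪b i, x⟫_ℝ := by
  classical
  have h1 := ((b.hasSum_repr x).mapL A).mapL (innerSL ℝ (b i))
  refine h1.unique ?_
  have h2 := hasSum_single (f := fun j ↦ innerSL ℝ (b i) (A (b.repr x j • b j))) i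
    (fun j hj ↦ by
      simp [hA, b.orthonormal.2 hj.symm])
  convert! h2 using 1
  simp [hA, b.repr_apply_apply, b.orthonormal.1 i, mul_comm]

lemma HilbertBasis.adjoint_of_diagonal {A : H →L[ℝ] H} {α : ι → ℝ}
    (hA : ∀ i, A (b i) = α i • b i) : ContinuousLinearMap.adjoint A = A := by
  refine b.clm_ext fun i ↦ ext_inner_right ℝ fun x ↦ ?_
  rw [ContinuousLinearMap.adjoint_inner_left, b.inner_apply_of_diagonal hA, hA,
    real_inner_smul_left]

omit [CompleteSpace H] in
lemma HilbertBasis.norm_apply_le_of_diagonal {A : H →L[ℝ] H} {α : ι → ℝ}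
    (hA : ∀ i, A (b i) = α i • b i) {M : ℝ} (hM : ∀ i, |α i| ≤ M) (hM0 : 0 ≤ M) (x : H) :
    ‖A x‖ ≤ M * ‖x‖ := by
  refine le_of_sq_le_sq ?_ (by positivity)
  have h1 := b.hasSum_inner_mul_inner (A x) (A x)
  have h2 := (b.hasSum_inner_mul_inner x x).mul_left (M ^ 2)
  rw [real_inner_self_eq_norm_sq] at h1 h2
  rw [mul_pow]
  refine hasSum_le (fun i ↦ ?_) h1 h2
  rw [real_inner_comm, real_inner_comm (b i) x, b.inner_apply_of_diagonal hA]
  have : α i ^ 2 ≤ M ^ 2 := sq_le_sq' (by linarith [neg_abs_le (α i), hM i])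
    (by linarith [le_abs_self (α i), hM i])
  nlinarith [sq_nonneg ⟪b i, x⟫_ℝ]

end Diagonal

/-! ### One-dimensional Gaussian densities -/

section Real

open scoped NNReal

lemma gaussianReal_sq_mul_le {v : ℝ≥0} (hv : v ≠ 0) {s : ℝ≥0} (hs0 : s ≠ 0) (hs : s ≤ 1) :
    gaussianReal 0 (s ^ 2 * v) ≤ (s⁻¹ : ℝ≥0) • gaussianReal 0 v := by
  rw [gaussianReal_of_var_ne_zero _ hv, gaussianReal_of_var_ne_zero _ (by positivity)]
  have : (s⁻¹ : ℝ≥0) • volume.withDensity (gaussianPDF 0 v) =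
      volume.withDensity (((s⁻¹ : ℝ≥0) : ℝ≥0∞) • gaussianPDF 0 v) := by
    rw [withDensity_smul _ (by fun_prop)]; rfl
  rw [this]
  refine withDensity_mono (Eventually.of_forall fun x ↦ ?_)
  have hs' : (0 : ℝ) < s := by positivity
  have hv' : (0 : ℝ) < v := by positivity
  have hs1 : (s : ℝ) ≤ 1 := by exact_mod_cast hs
  have hcast : ((s⁻¹ : ℝ≥0) : ℝ≥0∞) = ENNReal.ofReal ((s : ℝ)⁻¹) := by
    rw [← NNReal.coe_inv, ENNReal.ofReal_coe_nnreal]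
  simp only [Pi.smul_apply, smul_eq_mul, gaussianPDF_def]
  rw [hcast, ← ENNReal.ofReal_mul (by positivity)]
  refine ENNReal.ofReal_le_ofReal ?_
  simp only [gaussianPDFReal_def, NNReal.coe_mul, NNReal.coe_pow, sub_zero]
  have hsqrt : √(2 * Real.pi * (s ^ 2 * v)) = s * √(2 * Real.pi * v) := by
    rw [show 2 * Real.pi * (s ^ 2 * v) = (s : ℝ) ^ 2 * (2 * Real.pi * v) by ring,
      Real.sqrt_mul (by positivity), Real.sqrt_sq hs'.le]
  rw [hsqrt, mul_inv, mul_assoc]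
  gcongr _ * (_ * Real.exp ?_)
  rw [neg_div, neg_div, neg_le_neg_iff]
  gcongr
  have : (s : ℝ) ^ 2 ≤ 1 := pow_le_one₀ hs'.le hs1
  nlinarith

lemma gaussianReal_mean_eq_withDensity {c : ℝ≥0} (hc : c ≠ 0) :
    gaussianReal c c =
      (gaussianReal 0 c).withDensity fun x ↦ ENNReal.ofReal (Real.exp (x - c / 2)) := by
  rw [gaussianReal_of_var_ne_zero _ hc, gaussianReal_of_var_ne_zero _ hc,
    ← withDensity_mul _ (by fun_prop) (by fun_prop)]
  congr 1
  ext x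
  have hc' : (c : ℝ) ≠ 0 := by positivity
  simp only [Pi.mul_apply, gaussianPDF_def]
  rw [← ENNReal.ofReal_mul (gaussianPDFReal_nonneg _ _ _)]
  congr 1
  simp only [gaussianPDFReal_def]
  rw [mul_assoc _ (Real.exp _) (Real.exp _), ← Real.exp_add]
  congr 2
  field_simp
  ring

end Real

/-! ### Splitting off one coordinate of a Gaussian measure -/

section Gaussian

variable {H : Type*} [NormedAddCommGroup H] [InnerProductSpace ℝ H] [CompleteSpace H]
  [SecondCountableTopology H] [MeasurableSpace H] [BorelSpace H]
  {N : Measure H} [IsGaussian N]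

lemma map_inner_eq_gaussianReal (h0 : ∫ x, x ∂N = 0) (z : H) :
    N.map (fun y ↦ ⟪z, y⟫_ℝ) = gaussianReal 0 (covarianceBilin N z z).toNNReal := by
  have h := IsGaussian.map_eq_gaussianReal (μ := N) (innerSL ℝ z)
  have h1 : ∫ x, innerSL ℝ z x ∂N = 0 := by
    have := (innerSL ℝ z).integral_comp_comm (IsGaussian.integrable_id (μ := N))
    simpa only [id, h0, map_zero] using this
  rw [h1] at h
  rw [covarianceBilin_self IsGaussian.memLp_two_id]
  exact h

/-- If `⟪z, e⟫ = 1` and `e` is proportional to the image of `z` under the covariance operator, then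
the component `⟪z, y⟫` along `e` and the remainder `y - ⟪z, y⟫ e` are uncorrelated, hence
independent. -/
lemma lintegral_split (h0 : ∫ x, x ∂N = 0) {z e : H} {c : ℝ} (hze : ⟪z, e⟫_ℝ = 1)
    (hcov : ∀ ξ, covarianceBilin N ξ z = c * ⟪ξ, e⟫_ℝ) {g : H → ℝ → ℝ≥0∞}
    (hg : Measurable (Function.uncurry g)) :
    ∫⁻ y, g (y - ⟪z, y⟫_ℝ • e) ⟪z, y⟫_ℝ ∂N =
      ∫⁻ w, ∫⁻ ξ, g w ξ ∂(gaussianReal 0 c.toNNReal) ∂(N.map fun y ↦ y - ⟪z, y⟫_ℝ • e) := by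
  have hc : covarianceBilin N z z = c := by rw [hcov, hze, mul_one]
  let P : H →L[ℝ] H := ContinuousLinearMap.id ℝ H - (innerSL ℝ z).smulRight e
  have hP : (fun y ↦ y - ⟪z, y⟫_ℝ • e) = P := by ext y; simp [P]
  have hgauss : HasGaussianLaw (fun y ↦ (P y, innerSL ℝ z y)) N :=
    (IsGaussian.hasGaussianLaw_id (μ := N)).map_fun (P.prod (innerSL ℝ z))
  have hind : IndepFun (fun y ↦ P y) (fun y ↦ innerSL ℝ z y) N := by
    refine hgauss.indepFun_of_covariance_inner fun ξ r ↦ ?_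
    have e1 : (fun y ↦ ⟪ξ, P y⟫_ℝ) = fun y ↦ ⟪ξ - ⟪ξ, e⟫_ℝ • z, y⟫_ℝ := by
      ext y
      simp [P, inner_sub_right, inner_sub_left, real_inner_smul_left, real_inner_smul_right,
        mul_comm]
    have e2 : (fun y ↦ ⟪r, innerSL ℝ z y⟫_ℝ) = fun y ↦ ⟪r • z, y⟫_ℝ := by
      ext y
      simp [real_inner_smul_left, mul_comm]
    rw [e1, e2, ← covarianceBilin_apply_eq_cov IsGaussian.memLp_two_id]
    simp only [map_smul, map_sub, sub_apply, smul_apply,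
      smul_eq_mul, hcov, hze]
    ring
  have hmap := (indepFun_iff_map_prod_eq_prod_map_map (by fun_prop) (by fun_prop)).1 hind
  have hlaw : N.map (fun y ↦ innerSL ℝ z y) = gaussianReal 0 c.toNNReal := by
    rw [← hc]; exact map_inner_eq_gaussianReal h0 z
  rw [hlaw] at hmap
  rw [hP]
  have h1 := lintegral_prod (μ := N.map P) (ν := gaussianReal 0 c.toNNReal) _ hg.aemeasurable
  simp only [Function.uncurry_apply_pair] at h1
  rw [← h1, ← hmap, lintegral_map hg (by fun_prop)]
  simp [P]

/-- The Cameron–Martin formula for a shift `v` in the range of the covariance operator. -/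
lemma lintegral_comp_add_eq (h0 : ∫ x, x ∂N = 0) {z v : H}
    (hcov : ∀ ξ, covarianceBilin N ξ z = ⟪ξ, v⟫_ℝ) {g : H → ℝ≥0∞} (hg : Measurable g) :
    ∫⁻ y, g (y + v) ∂N =
      ∫⁻ y, g y * ENNReal.ofReal (Real.exp (⟪z, y⟫_ℝ - ⟪z, v⟫_ℝ / 2)) ∂N := by
  have hc0 : 0 ≤ ⟪z, v⟫_ℝ := by
    rw [← hcov]; exact covarianceBilin_self_nonneg z
  rcases hc0.eq_or_lt with hc | hc
  · -- A degenerate direction: both the shift and the exponent vanish.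
    have hv : v = 0 := by
      by_contra hne
      have hpos : 0 < ⟪v, v⟫_ℝ := real_inner_self_pos.2 hne
      have hzz : covarianceBilin N z z = 0 := by rw [hcov, ← hc]
      -- The variance of `⟪v + k z, ·⟫` is affine in `k` with slope `2 ‖v‖²`, yet nonnegative.
      have h1 : ∀ k : ℝ, 0 ≤ covarianceBilin N v v + 2 * k * ⟪v, v⟫_ℝ := by
        intro k
        have h2 := covarianceBilin_self_nonneg (μ := N) (v + k • z)
        simp only [map_smul, map_add, add_apply,
          smul_apply, smul_eq_mul, hzz, covarianceBilin_comm z v, hcov v] at h2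
        linarith
      have h3 := h1 (-(covarianceBilin N v v + 1) / (2 * ⟪v, v⟫_ℝ))
      field_simp at h3
      linarith
    have hlaw := map_inner_eq_gaussianReal h0 z
    rw [hcov, ← hc, Real.toNNReal_zero, gaussianReal_zero_var] at hlaw
    have hae : ∀ᵐ y ∂N, ⟪z, y⟫_ℝ = 0 := by
      refine ae_of_ae_map (f := fun y ↦ ⟪z, y⟫_ℝ) (p := fun x ↦ x = 0) (by fun_prop) ?_
      rw [hlaw]
      simp [ae_dirac_eq]
    refine lintegral_congr_ae (hae.mono fun y hy ↦ ?_)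
    simp [hy, hv]
  · set c := ⟪z, v⟫_ℝ
    have hcnn : c.toNNReal ≠ 0 := by simpa using hc
    have hcc : ((c.toNNReal : NNReal) : ℝ) = c := Real.coe_toNNReal _ hc.le
    set e := c⁻¹ • v
    have hve : v = c • e := by rw [smul_smul, mul_inv_cancel₀ hc.ne', one_smul]
    have hze : ⟪z, e⟫_ℝ = 1 := by
      rw [real_inner_smul_right]; exact inv_mul_cancel₀ hc.ne'
    have hcov' : ∀ ξ, covarianceBilin N ξ z = c * ⟪ξ, e⟫_ℝ := fun ξ ↦ by
      rw [hcov, ← real_inner_smul_right, ← hve]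
    have e1 := lintegral_split h0 hze hcov' (g := fun w ξ ↦ g (w + (ξ + c) • e))
      (by unfold Function.uncurry; fun_prop)
    have e2 := lintegral_split h0 hze hcov'
      (g := fun w ξ ↦ g (w + ξ • e) * ENNReal.ofReal (Real.exp (ξ - c / 2)))
      (by unfold Function.uncurry; fun_prop)
    have l1 : ∀ y, g (y - ⟪z, y⟫_ℝ • e + (⟪z, y⟫_ℝ + c) • e) = g (y + v) := fun y ↦ by
      rw [add_smul, ← hve]; congr 1; abel
    simp only [l1] at e1
    simp only [sub_add_cancel] at e2
    rw [e1, e2]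
    refine lintegral_congr fun w ↦ ?_
    have h3 := gaussianReal_map_add_const (μ := 0) (v := c.toNNReal) c
    have h4 := gaussianReal_mean_eq_withDensity hcnn
    rw [hcc] at h4
    rw [zero_add, h4] at h3
    rw [← lintegral_map (f := fun ξ ↦ g (w + ξ • e)) (g := fun ξ ↦ ξ + c) (by fun_prop)
      (by fun_prop), h3, lintegral_withDensity_eq_lintegral_mul _ (by fun_prop) (by fun_prop)]
    simp [mul_comm]

open scoped NNReal in
/-- Contracting one eigendirection `e` of the covariance by a factor `s` increases a centered
Gaussian measure by at most the factor `s⁻¹`, the ratio of the one-dimensional densities at the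
origin. -/
lemma map_contraction_le (h0 : ∫ x, x ∂N = 0) {e : H} (he : ‖e‖ = 1) {c : ℝ} (hc : 0 < c)
    (hcov : ∀ ξ, covarianceBilin N ξ e = c * ⟪ξ, e⟫_ℝ) {s : ℝ≥0} (hs0 : s ≠ 0) (hs : s ≤ 1) :
    N.map (fun y ↦ y - ((1 - s) * ⟪e, y⟫_ℝ) • e) ≤ (s⁻¹ : ℝ≥0) • N := by
  have hee : ⟪e, e⟫_ℝ = 1 := by rw [real_inner_self_eq_norm_sq, he, one_pow]
  refine Measure.le_iff.2 fun A hA ↦ ?_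
  rw [Measure.map_apply (by fun_prop) hA, ← lintegral_indicator_one
    (measurableSet_preimage (by fun_prop) hA)]
  have hm : Measurable (A.indicator (1 : H → ℝ≥0∞)) := measurable_one.indicator hA
  have e1 := lintegral_split h0 hee hcov (g := fun w ξ ↦ A.indicator 1 (w + ((s : ℝ) * ξ) • e))
    (hm.comp (by fun_prop))
  have e2 := lintegral_split h0 hee hcov (g := fun w ξ ↦ A.indicator 1 (w + ξ • e))
    (hm.comp (by fun_prop))
  have l1 : ∀ y, A.indicator (1 : H → ℝ≥0∞) (y - ⟪e, y⟫_ℝ • e + ((s : ℝ) * ⟪e, y⟫_ℝ) • e) =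
      ((fun y ↦ y - ((1 - s) * ⟪e, y⟫_ℝ) • e) ⁻¹' A).indicator 1 y := fun y ↦ by
    have : y - ⟪e, y⟫_ℝ • e + ((s : ℝ) * ⟪e, y⟫_ℝ) • e = y - ((1 - s) * ⟪e, y⟫_ℝ) • e := by
      module
    rw [this]; rfl
  simp only [l1] at e1
  simp only [sub_add_cancel] at e2
  rw [e1, Measure.smul_apply, ← lintegral_indicator_one hA, e2, ENNReal.smul_def, smul_eq_mul,
    ← lintegral_const_mul _ (by
      refine Measurable.lintegral_prod_right' (ν := gaussianReal 0 c.toNNReal) (f := fun p : H × ℝ ↦ A.indicator 1 (p.1 + p.2 • e)) ?_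
      exact hm.comp (by fun_prop))]
  refine lintegral_mono fun w ↦ ?_
  have h3 := gaussianReal_map_const_mul (μ := 0) (v := c.toNNReal) s
  have hcnn : c.toNNReal ≠ 0 := by simpa using hc
  rw [← lintegral_map (f := fun ξ ↦ A.indicator 1 (w + ξ • e)) (g := fun ξ ↦ (s : ℝ) * ξ)
    (hm.comp (by fun_prop)) (by fun_prop), h3]
  have h4 := gaussianReal_sq_mul_le hcnn hs0 hs
  have h5 : gaussianReal (s * 0) (NNReal.mk ((s : ℝ) ^ 2) (sq_nonneg _) * c.toNNReal) =
      gaussianReal 0 (s ^ 2 * c.toNNReal) := by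
    rw [mul_zero]; congr
  rw [h5]
  refine (lintegral_mono' h4 le_rfl).trans (le_of_eq ?_)
  rw [lintegral_smul_measure]; rfl

end Gaussian

/-! ### The covariance operator and images of a Gaussian measure -/

section Covariance

variable {H : Type*} [NormedAddCommGroup H] [InnerProductSpace ℝ H] [CompleteSpace H]
  [SecondCountableTopology H] [MeasurableSpace H] [BorelSpace H]
  {m : Measure H} [IsGaussian m]

lemma covarianceBilin_eq_inner_covarianceOperator (h0 : ∫ x, x ∂m = 0) (x y : H) :
    covarianceBilin m x y = ⟪covarianceOperator m x, y⟫_ℝ := by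
  rw [covarianceBilin_apply IsGaussian.memLp_two_id,
    covarianceOperator_inner IsGaussian.memLp_two_id]
  simp [h0]

lemma integrable_norm_sq : Integrable (fun x : H ↦ ‖x‖ ^ 2) m :=
  (IsGaussian.memLp_two_id (μ := m)).integrable_norm_pow (by norm_num)

/-- Compactness is preserved by the Bochner integral of rank one operators, as the compact operators
form a closed convex set. -/
lemma isCompactOperator_covarianceOperator : IsCompactOperator (covarianceOperator m) := by
  have hint : Integrable (fun x : H ↦ InnerProductSpace.rankOne ℝ x x) m := by
    have := secondCountableTopologyEither_of_left H (H →L[ℝ] H)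
    refine Integrable.mono' integrable_norm_sq
      ((InnerProductSpace.rankOne ℝ).continuous.clm_apply
        continuous_id).aestronglyMeasurable (Eventually.of_forall fun x ↦ ?_)
    simp [sq]
  have heq : covarianceOperator m = ∫ x, InnerProductSpace.rankOne ℝ x x ∂m := by
    ext v
    rw [covarianceOperator_apply IsGaussian.memLp_two_id,
      ContinuousLinearMap.integral_apply hint]
    simp [real_inner_comm]
  have hclosed := isClosed_setOfPred_isCompactOperator (σ₁₂ := RingHom.id ℝ) (M₁ := H) (M₂ := H)
  have hconv : Convex ℝ {f : H →L[ℝ] H | IsCompactOperator f} :=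
    (compactOperator (RingHom.id ℝ) H H).convex
  rw [heq]
  refine hconv.integral_mem hclosed (Eventually.of_forall fun x ↦ ?_) hint
  have : (InnerProductSpace.rankOne ℝ x x : H → H) =
      (ContinuousLinearMap.toSpanSingleton ℝ x) ∘ (innerSL ℝ x) := by
    ext y; simp
  simp only [Set.mem_ofPred_eq, this]
  have hspan : IsCompactOperator (ContinuousLinearMap.toSpanSingleton ℝ x) :=
    isCompactOperator_of_locallyCompactSpace_rng _
  exact hspan.comp_clm (innerSL ℝ x)

lemma isPosTraceClass_covarianceOperator (hnondeg : ∀ x : H, covarianceOperator m x = 0 → x = 0) :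
    IsPosTraceClass (covarianceOperator m) (∫ x, ‖x‖ ^ 2 ∂m) where
  symm := isPositive_covarianceOperator.1
  compact := isCompactOperator_covarianceOperator
  pos x hx := by
    have hnn : 0 ≤ ⟪covarianceOperator m x, x⟫_ℝ := isPositive_covarianceOperator.2 x
    refine hnn.lt_of_ne fun h ↦ hx (hnondeg x ?_)
    rw [covarianceOperator_inner IsGaussian.memLp_two_id] at h
    have hint : Integrable (fun y : H ↦ ⟪x, y⟫_ℝ * ⟪x, y⟫_ℝ) m := by
      have := ((IsGaussian.memLp_two_id (μ := m)).const_inner x).integrable_sq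
      simpa [sq] using this
    have hae := (integral_eq_zero_iff_of_nonneg (fun y ↦ mul_self_nonneg _) hint).1 h.symm
    rw [covarianceOperator_apply IsGaussian.memLp_two_id]
    refine integral_eq_zero_of_ae (hae.mono fun y hy ↦ ?_)
    have : ⟪x, y⟫_ℝ = 0 := by simpa using hy
    simp [this]
  sum_le F hF := by
    simp_rw [covarianceOperator_inner IsGaussian.memLp_two_id]
    have hint : ∀ v : H, Integrable (fun y : H ↦ ⟪v, y⟫_ℝ * ⟪v, y⟫_ℝ) m := fun v ↦ by
      have := ((IsGaussian.memLp_two_id (μ := m)).const_inner v).integrable_sq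
      simpa [sq] using this
    rw [← integral_finsetSum _ fun v _ ↦ hint v]
    refine integral_mono (integrable_finsetSum _ fun v _ ↦ hint v) integrable_norm_sq fun x ↦ ?_
    have h := hF.sum_inner_products_le (s := Finset.univ) x
    rw [Finset.univ_eq_attach, Finset.sum_attach F (fun v ↦ ‖⟪v, x⟫_ℝ‖ ^ 2)] at h
    simpa [sq] using h

/-- The covariance of the image measure under a self-adjoint operator. -/
lemma covarianceBilin_map_of_adjoint_eq (h0 : ∫ x, x ∂m = 0) {S : H →L[ℝ] H}
    (hS : ContinuousLinearMap.adjoint S = S) (x y : H) :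
    covarianceBilin (m.map S) x y = ⟪S (covarianceOperator m (S x)), y⟫_ℝ := by
  rw [covarianceBilin_map IsGaussian.memLp_two_id, hS,
    covarianceBilin_eq_inner_covarianceOperator h0]
  conv_rhs => rw [← hS, ContinuousLinearMap.adjoint_inner_left, hS]

lemma integral_map_eq_zero (h0 : ∫ x, x ∂m = 0) (S : H →L[ℝ] H) :
    ∫ x, x ∂(m.map S) = 0 := by
  have h := S.integral_id_map (μ := m) IsGaussian.integrable_id
  simpa [h0] using h

lemma eq_of_isGaussianWith {a : H} {C : H →L[ℝ] H} {μ ν : Measure H} (hμ : IsGaussianWith a C μ)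
    (hν : IsGaussianWith a C ν) : μ = ν := by
  have := hμ.1
  have := hν.1
  refine IsGaussian.ext ?_ ?_
  · simp [hμ.2.1, hν.2.1]
  · ext x y
    rw [hμ.2.2, hν.2.2]

omit [CompleteSpace H] [SecondCountableTopology H] in
lemma isGaussianWith_gaussianN {a : H} {C : H →L[ℝ] H} {μ : Measure H}
    (h : IsGaussianWith a C μ) : IsGaussianWith a C (gaussianN a C) := by
  have hex : ∃ μ : Measure H, IsGaussianWith a C μ := ⟨μ, h⟩
  rw [gaussianN, dif_pos hex]
  exact hex.choose_spec

open scoped NNReal in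
/-- Contracting finitely many eigendirections of the covariance, one after the other. -/
lemma map_sub_sum_le (h0 : ∫ x, x ∂m = 0) {ι : Type*} {b : ι → H} (hb : Orthonormal ℝ b)
    {l : ι → ℝ} (hl : ∀ i, 0 < l i) (hQ : ∀ i, covarianceOperator m (b i) = l i • b i)
    {s : ι → ℝ≥0} (hs0 : ∀ i, s i ≠ 0) (hs : ∀ i, s i ≤ 1) (F : Finset ι) :
    m.map (fun y ↦ y - ∑ i ∈ F, ((1 - s i) * ⟪b i, y⟫_ℝ) • b i) ≤ (∏ i ∈ F, (s i)⁻¹) • m := by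
  classical
  induction F using Finset.induction_on with
  | empty => simp
  | insert j F hj ih =>
    set T : H → H := fun y ↦ y - ∑ i ∈ F, ((1 - s i) * ⟪b i, y⟫_ℝ) • b i
    have hT : Measurable T := by fun_prop
    have hcomp : (fun y ↦ y - ∑ i ∈ insert j F, ((1 - (s i : ℝ)) * ⟪b i, y⟫_ℝ) • b i) =
        T ∘ fun y ↦ y - ((1 - (s j : ℝ)) * ⟪b j, y⟫_ℝ) • b j := by
      ext y
      simp only [T, Function.comp_apply]
      rw [Finset.sum_insert hj, ← sub_sub]
      congr 1
      refine Finset.sum_congr rfl fun i hi ↦ ?_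
      -- Contracting along `b j` leaves the other coordinates unchanged.
      have hij : i ≠ j := fun h ↦ hj (h ▸ hi)
      rw [inner_sub_right, real_inner_smul_right, hb.2 hij, mul_zero, sub_zero]
    have hstep : m.map (fun y ↦ y - ((1 - (s j : ℝ)) * ⟪b j, y⟫_ℝ) • b j) ≤ ((s j)⁻¹ : ℝ≥0) • m :=
      map_contraction_le h0 (hb.1 j) (hl j) (fun ξ ↦ by
        rw [covarianceBilin_comm, covarianceBilin_eq_inner_covarianceOperator h0, hQ,
          real_inner_smul_left, real_inner_comm]) (hs0 j) (hs j)
    rw [hcomp, ← Measure.map_map hT (by fun_prop), Finset.prod_insert hj]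
    calc _ ≤ Measure.map T (((s j)⁻¹ : ℝ≥0) • m) := Measure.map_mono hstep hT
      _ = ((s j)⁻¹ : ℝ≥0) • m.map T := Measure.map_smul ..
      _ ≤ ((s j)⁻¹ : ℝ≥0) • (∏ i ∈ F, (s i)⁻¹) • m := by gcongr
      _ = _ := by rw [smul_smul]

open scoped NNReal in
/-- Domination of image measures passes to pointwise limits of the maps: Fatou's lemma gives it on
open sets, and outer regularity on all sets. -/
lemma map_le_of_tendsto {X : Type*} [MeasurableSpace X] {m : Measure X} {E : Type*}
    [PseudoMetricSpace E] [MeasurableSpace E] [BorelSpace E] {ν : Measure E} [IsFiniteMeasure ν]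
    {T : ℕ → X → E} {S : X → E} (hT : ∀ n, Measurable (T n)) (hS : Measurable S)
    (hlim : ∀ x, Tendsto (fun n ↦ T n x) atTop (𝓝 (S x))) {C : ℝ≥0∞}
    (hle : ∀ n, m.map (T n) ≤ C • ν) (hC : C ≠ ⊤) : m.map S ≤ C • ν := by
  have hopen : ∀ U : Set E, IsOpen U → m.map S U ≤ C * ν U := by
    intro U hU
    rw [Measure.map_apply hS hU.measurableSet,
      ← lintegral_indicator_one (hS hU.measurableSet)]
    calc ∫⁻ x, (S ⁻¹' U).indicator 1 x ∂m
        ≤ ∫⁻ x, liminf (fun n ↦ (T n ⁻¹' U).indicator (1 : X → ℝ≥0∞) x) atTop ∂m := by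
          refine lintegral_mono fun x ↦ ?_
          by_cases hx : S x ∈ U
          · refine le_liminf_of_le (by isBoundedDefault) ?_
            filter_upwards [(hlim x).eventually (hU.mem_nhds hx)] with n hn
            have h1 : x ∈ S ⁻¹' U := hx
            have h2 : x ∈ T n ⁻¹' U := hn
            simp [h1, h2]
          · have h1 : x ∉ S ⁻¹' U := hx
            simp [h1]
      _ ≤ liminf (fun n ↦ ∫⁻ x, (T n ⁻¹' U).indicator (1 : X → ℝ≥0∞) x ∂m) atTop :=
          lintegral_liminf_le fun n ↦ measurable_one.indicator (hT n hU.measurableSet)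
      _ ≤ C * ν U := by
          refine liminf_le_of_le (by isBoundedDefault) fun a ha ↦ ?_
          obtain ⟨n, hn⟩ := ha.exists
          refine hn.trans ?_
          rw [lintegral_indicator_one (hT n hU.measurableSet),
            ← Measure.map_apply (hT n) hU.measurableSet]
          exact hle n U
  have : (C • ν).OuterRegular := Measure.OuterRegular.smul ν hC
  refine Measure.le_iff.2 fun A _ ↦ ?_
  rw [Set.measure_eq_iInf_isOpen A (C • ν)]
  refine le_iInf fun U ↦ le_iInf fun hAU ↦ le_iInf fun hU ↦ ?_
  exact (measure_mono hAU).trans (hopen U hU)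

end Covariance

/-! ### The operators of the Mehler semigroup -/

section Mehler

variable {H : Type*} [NormedAddCommGroup H] [InnerProductSpace ℝ H] [CompleteSpace H]

lemma exp_neg_div_le {c l : ℝ} (hc : 0 < c) (hl : 0 < l) : Real.exp (-(c / l)) ≤ l / c := by
  rw [Real.exp_neg, ← inv_div c l]
  exact inv_anti₀ (by positivity) (by linarith [Real.add_one_le_exp (c / l)])

lemma exp_neg_inv_le_one_sub_exp_neg {u : ℝ} (hu : 0 < u) :
    Real.exp (-u⁻¹) ≤ 1 - Real.exp (-u) := by
  have h1 : Real.exp (-u⁻¹) ≤ (u⁻¹ + 1)⁻¹ := by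
    rw [Real.exp_neg]
    exact inv_anti₀ (by positivity) (Real.add_one_le_exp _)
  have h2 : Real.exp (-u) ≤ (u + 1)⁻¹ := by
    rw [Real.exp_neg]
    exact inv_anti₀ (by positivity) (Real.add_one_le_exp _)
  have h3 : (u⁻¹ + 1)⁻¹ + (u + 1)⁻¹ = 1 := by field_simp; ring
  linarith

/-- The eigenvalue of `e^{tA} Q_t⁻¹` belonging to the eigenvalue `l` of `Q`. -/
noncomputable def shiftSymbol (t l : ℝ) : ℝ :=
  Real.exp (-t / (2 * l)) / (l * (1 - Real.exp (-t / l)))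

/-- The operator `Q_t⁻¹ e^{tA}`; it is bounded since its eigenvalues vanish as those of `Q` tend
to `0`. -/
noncomputable def shiftOp (Q : H →L[ℝ] H) (t : ℝ) : H →L[ℝ] H :=
  spectralSum Q (shiftSymbol t)

/-- The operator `(1 - e^{2tA})^{1/2}`, whose eigenvalues are `√(1 - e^{-t/l})`. It is written as
a perturbation of the identity because `1 - √(1 - e^{-t/l})` is summable. -/
noncomputable def rootOp (Q : H →L[ℝ] H) (t : ℝ) : H →L[ℝ] H :=
  ContinuousLinearMap.id ℝ H - spectralSum Q fun l ↦ 1 - √(1 - Real.exp (-t / l))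

lemma abs_exp_le_mul {s : ℝ} (hs : 0 < s) (l : ℝ) (hl : 0 < l) :
    |Real.exp (-s / (2 * l))| ≤ 2 / s * l := by
  rw [Real.abs_exp, neg_div, show 2 / s * l = (2 * l) / s by ring]
  exact exp_neg_div_le hs (by positivity)

lemma one_sub_exp_pos {t l : ℝ} (ht : 0 < t) (hl : 0 < l) : 0 < 1 - Real.exp (-t / l) := by
  have : Real.exp (-t / l) < 1 := by
    rw [Real.exp_lt_one_iff, neg_div]
    exact neg_neg_of_pos (by positivity)
  linarith

lemma abs_one_sub_sqrt_le {t : ℝ} (ht : 0 < t) (l : ℝ) (hl : 0 < l) :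
    |1 - √(1 - Real.exp (-t / l))| ≤ 1 / t * l := by
  have h1 := one_sub_exp_pos ht hl
  have h2 : 1 - Real.exp (-t / l) ≤ 1 := by linarith [Real.exp_pos (-t / l)]
  have h3 : √(1 - Real.exp (-t / l)) ≤ 1 := Real.sqrt_le_one.2 h2
  have h4 : 1 - Real.exp (-t / l) ≤ √(1 - Real.exp (-t / l)) := by
    rw [Real.le_sqrt h1.le h1.le]; nlinarith
  rw [abs_of_nonneg (by linarith)]
  have h5 := exp_neg_div_le ht hl
  rw [← neg_div] at h5
  rw [show 1 / t * l = l / t by ring]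
  linarith

lemma shiftSymbol_nonneg {t l : ℝ} (ht : 0 < t) (hl : 0 < l) : 0 ≤ shiftSymbol t l :=
  div_nonneg (Real.exp_pos _).le (mul_pos hl (one_sub_exp_pos ht hl)).le

lemma sq_exp_half (t l : ℝ) :
    Real.exp (-t / (2 * l)) * Real.exp (-t / (2 * l)) = Real.exp (-t / l) := by
  rw [← Real.exp_add]
  congr 1
  by_cases hl : l = 0
  · simp [hl]
  · field_simp
    ring

lemma abs_shiftSymbol_le {t : ℝ} (ht : 0 < t) (l : ℝ) (hl : 0 < l) :
    |shiftSymbol t l| ≤ 8 / t ^ 2 * l := by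
  rw [abs_of_nonneg (shiftSymbol_nonneg ht hl), shiftSymbol,
    div_le_iff₀ (mul_pos hl (one_sub_exp_pos ht hl))]
  -- With `u = t / (2 l)` and `a = e^{-u}` the claim is `a ≤ (2 / u²) (1 - a²)`.
  set u := t / (2 * l) with hu
  have hu0 : 0 < u := by positivity
  have ha : -t / (2 * l) = -u := by rw [hu, neg_div]
  have haa := sq_exp_half t l
  rw [ha] at haa ⊢
  rw [← haa]
  have he : 8 / t ^ 2 * l * (l * (1 - Real.exp (-u) * Real.exp (-u))) =
      2 / u ^ 2 * (1 - Real.exp (-u) * Real.exp (-u)) := by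
    rw [hu]; field_simp; ring
  rw [he]
  have h1 : 1 + u + u ^ 2 / 2 ≤ Real.exp u := Real.quadratic_le_exp_of_nonneg hu0.le
  have h2 : Real.exp (-u) * Real.exp u = 1 := by rw [← Real.exp_add]; simp
  have h3 : Real.exp (-u) ≤ 1 := by rw [Real.exp_le_one_iff]; linarith
  have h4 : 0 < Real.exp (-u) := Real.exp_pos _
  have h5 : Real.exp (-u) * (u ^ 2 / 2) ≤ 1 - Real.exp (-u) * Real.exp (-u) := by
    nlinarith
  rw [div_mul_eq_mul_div, le_div_iff₀ (by positivity)]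
  linarith

lemma exp_mul_shiftSymbol_le {t l : ℝ} (ht : 0 < t) (hl : 0 < l) :
    Real.exp (-t / (2 * l)) * shiftSymbol t l ≤ 1 / t := by
  rw [shiftSymbol, mul_div_assoc', sq_exp_half, div_le_div_iff₀
    (mul_pos hl (one_sub_exp_pos ht hl)) ht, one_mul]
  have h1 := Real.add_one_le_exp (t / l)
  have h2 : Real.exp (-t / l) * Real.exp (t / l) = 1 := by
    rw [← Real.exp_add, neg_div, neg_add_cancel, Real.exp_zero]
  have h4 : 0 < Real.exp (-t / l) := Real.exp_pos _
  have h3 : Real.exp (-t / l) * (t / l) ≤ 1 - Real.exp (-t / l) := by nlinarith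
  calc Real.exp (-t / l) * t = l * (Real.exp (-t / l) * (t / l)) := by field_simp
    _ ≤ l * (1 - Real.exp (-t / l)) := by gcongr

namespace IsPosTraceClass

variable {Q : H →L[ℝ] H} {K : ℝ} (hQ : IsPosTraceClass Q K) {t : ℝ} (ht : 0 < t)
include hQ ht

lemma expA_apply_of_eigen {l : ℝ} {v : H} (hv : Q v = l • v) :
    expA Q t v = Real.exp (-t / (2 * l)) • v :=
  hQ.spectralSum_apply_of_eigen (abs_exp_le_mul ht) hv

lemma shiftOp_apply_of_eigen {l : ℝ} {v : H} (hv : Q v = l • v) :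
    shiftOp Q t v = shiftSymbol t l • v :=
  hQ.spectralSum_apply_of_eigen (abs_shiftSymbol_le ht) hv

lemma rootOp_apply_of_eigen {l : ℝ} {v : H} (hv : Q v = l • v) :
    rootOp Q t v = √(1 - Real.exp (-t / l)) • v := by
  rw [rootOp, sub_apply, hQ.spectralSum_apply_of_eigen (abs_one_sub_sqrt_le ht) hv,
    ContinuousLinearMap.id_apply]
  module

lemma covAt_apply_of_eigen {l : ℝ} {v : H} (hv : Q v = l • v) :
    covAt Q t v = (l * (1 - Real.exp (-t / l))) • v := by
  rw [covAt, ContinuousLinearMap.comp_apply, sub_apply, ContinuousLinearMap.id_apply,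
    hQ.expA_apply_of_eigen (by positivity) hv, map_sub, map_smul, hv,
    show -(2 * t) / (2 * l) = -t / l by rw [← mul_neg, mul_div_mul_left _ _ two_ne_zero]]
  module

lemma adjoint_rootOp : ContinuousLinearMap.adjoint (rootOp Q t) = rootOp Q t := by
  obtain ⟨ι, b, l, hb⟩ := hQ.exists_hilbertBasis_eigen
  exact b.adjoint_of_diagonal fun i ↦ hQ.rootOp_apply_of_eigen ht (hb i)

lemma rootOp_comp_comp_rootOp (x : H) : rootOp Q t (Q (rootOp Q t x)) = covAt Q t x := by
  obtain ⟨ι, b, l, hb⟩ := hQ.exists_hilbertBasis_eigen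
  have : rootOp Q t ∘L Q ∘L rootOp Q t = covAt Q t := b.clm_ext fun i ↦ by
    have hl := hQ.eigenvalue_pos (hb i) (b.orthonormal.ne_zero i)
    have h1 := Real.mul_self_sqrt (one_sub_exp_pos ht hl).le
    simp only [ContinuousLinearMap.comp_apply, hQ.rootOp_apply_of_eigen ht (hb i), map_smul, hb,
      hQ.covAt_apply_of_eigen ht (hb i), smul_smul]
    congr 1
    linear_combination l i * h1
  exact congr($this x)

lemma covAt_shiftOp (x : H) : covAt Q t (shiftOp Q t x) = expA Q t x := by
  obtain ⟨ι, b, l, hb⟩ := hQ.exists_hilbertBasis_eigen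
  have : covAt Q t ∘L shiftOp Q t = expA Q t := b.clm_ext fun i ↦ by
    have hl := hQ.eigenvalue_pos (hb i) (b.orthonormal.ne_zero i)
    have h1 := one_sub_exp_pos ht hl
    simp only [ContinuousLinearMap.comp_apply, hQ.shiftOp_apply_of_eigen ht (hb i), map_smul,
      hQ.covAt_apply_of_eigen ht (hb i), hQ.expA_apply_of_eigen ht (hb i), smul_smul]
    congr 1
    exact div_mul_cancel₀ _ (mul_pos hl h1).ne'
  exact congr($this x)

lemma norm_expA_apply_le (x : H) : ‖expA Q t x‖ ≤ ‖x‖ := by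
  obtain ⟨ι, b, l, hb⟩ := hQ.exists_hilbertBasis_eigen
  have := b.norm_apply_le_of_diagonal (fun i ↦ hQ.expA_apply_of_eigen ht (hb i)) (M := 1)
    (fun i ↦ by
      have hl := hQ.eigenvalue_pos (hb i) (b.orthonormal.ne_zero i)
      rw [Real.abs_exp, Real.exp_le_one_iff, neg_div]
      exact neg_nonpos.2 (by positivity)) zero_le_one x
  simpa using this

/-- The Cameron–Martin norm of `e^{tA} h` relative to `Q_t` satisfies
`⟪Q_t⁻¹ e^{tA} h, e^{tA} h⟫ ≤ ‖h‖² / t`. -/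
lemma inner_shiftOp_expA_le (x : H) : ⟪shiftOp Q t x, expA Q t x⟫_ℝ ≤ ‖x‖ ^ 2 / t := by
  obtain ⟨ι, b, l, hb⟩ := hQ.exists_hilbertBasis_eigen
  have hadj := b.adjoint_of_diagonal fun i ↦ hQ.expA_apply_of_eigen ht (hb i)
  have h1 : ∀ i, (expA Q t ∘L shiftOp Q t) (b i) =
      (Real.exp (-t / (2 * l i)) * shiftSymbol t (l i)) • b i := fun i ↦ by
    simp only [ContinuousLinearMap.comp_apply, hQ.shiftOp_apply_of_eigen ht (hb i), map_smul,
      hQ.expA_apply_of_eigen ht (hb i), smul_smul]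
    rw [mul_comm]
  have h2 := b.norm_apply_le_of_diagonal h1 (M := 1 / t) (fun i ↦ by
      have hl := hQ.eigenvalue_pos (hb i) (b.orthonormal.ne_zero i)
      rw [abs_of_nonneg (mul_nonneg (Real.exp_pos _).le (shiftSymbol_nonneg ht hl))]
      exact exp_mul_shiftSymbol_le ht hl) (by positivity) x
  rw [← hadj, ContinuousLinearMap.adjoint_inner_right]
  calc ⟪expA Q t (shiftOp Q t x), x⟫_ℝ ≤ ‖expA Q t (shiftOp Q t x)‖ * ‖x‖ := real_inner_le_norm _ _
    _ ≤ 1 / t * ‖x‖ * ‖x‖ := by gcongr; exact h2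
    _ = ‖x‖ ^ 2 / t := by ring

end IsPosTraceClass

end Mehler

/-! ### The measure of the Mehler formula -/

section MehlerGaussian

open scoped NNReal

variable {H : Type*} [NormedAddCommGroup H] [InnerProductSpace ℝ H] [CompleteSpace H]
  [SecondCountableTopology H] [MeasurableSpace H] [BorelSpace H]
  {m : Measure H} [IsGaussian m]

/-- `N_{Q_t}` is the law of `(1 - e^{2tA})^{1/2} y` under `m`. -/
lemma isGaussianWith_map_rootOp (h0 : ∫ x, x ∂m = 0) {K : ℝ}
    (hQ : IsPosTraceClass (covarianceOperator m) K) {t : ℝ} (ht : 0 < t) :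
    IsGaussianWith 0 (covAt (covarianceOperator m) t) (m.map (rootOp (covarianceOperator m) t)) :=
  ⟨inferInstance, integral_map_eq_zero h0 _, fun x y ↦ by
    rw [covarianceBilin_map_of_adjoint_eq h0 (hQ.adjoint_rootOp ht),
      hQ.rootOp_comp_comp_rootOp ht]⟩

/-- `N_{Q_t} ≤ e^{tr Q / (2 t)} m`: the density of `N_{Q_t}` with respect to `m` is largest at the
origin, where it equals `∏ (1 - e^{-t/l})^{-1/2}`. -/
lemma map_rootOp_le (h0 : ∫ x, x ∂m = 0) {K : ℝ}
    (hQ : IsPosTraceClass (covarianceOperator m) K) {t : ℝ} (ht : 0 < t) :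
    m.map (rootOp (covarianceOperator m) t) ≤ ENNReal.ofReal (Real.exp (K / (2 * t))) • m := by
  obtain ⟨ι, b, l, hb⟩ := hQ.exists_hilbertBasis_eigen
  have hl : ∀ i, 0 < l i := fun i ↦ hQ.eigenvalue_pos (hb i) (b.orthonormal.ne_zero i)
  -- The eigenvalues are positive and summable, so there are countably many basis vectors, and the
  -- finite sets of them are exhausted by a sequence, as Fatou's lemma requires.
  have : Countable ι := by
    have h := (hQ.summable_eigenvalue b.orthonormal hb).countable_support
    rw [show Function.support l = Set.univ from Set.eq_univ_of_forall fun i ↦ (hl i).ne'] at h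
    exact Set.countable_univ_iff.1 h
  obtain ⟨F, hF⟩ := exists_seq_tendsto (atTop : Filter (Finset ι))
  set s : ι → ℝ≥0 := fun i ↦ ⟨√(1 - Real.exp (-t / l i)), Real.sqrt_nonneg _⟩
  have hs0 : ∀ i, s i ≠ 0 := fun i h ↦
    (Real.sqrt_pos.2 (one_sub_exp_pos ht (hl i))).ne' (congrArg NNReal.toReal h)
  have hs1 : ∀ i, s i ≤ 1 := fun i ↦ by
    rw [← NNReal.coe_le_coe]
    exact Real.sqrt_le_one.2 (by linarith [Real.exp_pos (-t / l i)])
  have hinv : ∀ i, (((s i)⁻¹ : ℝ≥0) : ℝ) ≤ Real.exp (l i / (2 * t)) := fun i ↦ by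
    have h1 := exp_neg_inv_le_one_sub_exp_neg (div_pos ht (hl i))
    rw [inv_div, ← neg_div (l i) t] at h1
    have h2 : Real.exp (-(l i / (2 * t))) ≤ √(1 - Real.exp (-t / l i)) := by
      refine Real.le_sqrt_of_sq_le (le_trans (le_of_eq ?_) h1)
      rw [sq, ← Real.exp_add]
      congr 1
      field_simp
      ring
    rw [NNReal.coe_inv, ← neg_neg (l i / (2 * t)), Real.exp_neg]
    exact inv_anti₀ (Real.exp_pos _) h2
  refine map_le_of_tendsto (T := fun n y ↦ y - ∑ i ∈ F n, ((1 - s i) * ⟪b i, y⟫_ℝ) • b i)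
    (fun n ↦ by fun_prop) (by fun_prop) (fun x ↦ ?_) (fun n ↦ ?_) ENNReal.ofReal_ne_top
  · have h1 := (b.hasSum_repr x).mapL
      (spectralSum (covarianceOperator m) fun l ↦ 1 - √(1 - Real.exp (-t / l)))
    convert! (tendsto_const_nhds (x := x)).sub (Tendsto.comp h1 hF) using 2 with n
    congr 1
    refine Finset.sum_congr rfl fun i _ ↦ ?_
    refine Eq.symm ((map_smul (spectralSum (covarianceOperator m) _) _ _).trans ?_)
    rw [hQ.spectralSum_apply_of_eigen (abs_one_sub_sqrt_le ht) (hb i), smul_smul,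
      b.repr_apply_apply, mul_comm]
    rfl
  · refine (map_sub_sum_le h0 b.orthonormal hl hb hs0 hs1 (F n)).trans ?_
    refine Measure.le_iff.2 fun A _ ↦ ?_
    rw [Measure.smul_apply, Measure.smul_apply, ENNReal.smul_def, smul_eq_mul, smul_eq_mul]
    gcongr
    rw [← ENNReal.ofReal_coe_nnreal]
    refine ENNReal.ofReal_le_ofReal ?_
    calc ((∏ i ∈ F n, (s i)⁻¹ : ℝ≥0) : ℝ) = ∏ i ∈ F n, (((s i)⁻¹ : ℝ≥0) : ℝ) := by push_cast; rfl
      _ ≤ ∏ i ∈ F n, Real.exp (l i / (2 * t)) :=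
          Finset.prod_le_prod (fun i _ ↦ NNReal.coe_nonneg _) fun i _ ↦ hinv i
      _ = Real.exp ((∑ i ∈ F n, l i) / (2 * t)) := by rw [← Real.exp_sum, Finset.sum_div]
      _ ≤ Real.exp (K / (2 * t)) := by
          gcongr
          exact hQ.sum_eigenvalue_le b.orthonormal hb _

end MehlerGaussian

/-! ### Comparison of Mehler kernels -/

section Comparison

variable {H : Type*} [NormedAddCommGroup H] [InnerProductSpace ℝ H] [CompleteSpace H]
  [SecondCountableTopology H] [MeasurableSpace H] [BorelSpace H]
  {m : Measure H} [IsGaussian m]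

lemma isGaussianWith_gaussianN_covAt (h0 : ∫ x, x ∂m = 0) {K : ℝ}
    (hQ : IsPosTraceClass (covarianceOperator m) K) {t : ℝ} (ht : 0 < t) :
    IsGaussianWith 0 (covAt (covarianceOperator m) t)
      (gaussianN 0 (covAt (covarianceOperator m) t)) :=
  isGaussianWith_gaussianN (isGaussianWith_map_rootOp h0 hQ ht)

lemma gaussianN_covAt_le (h0 : ∫ x, x ∂m = 0) {K : ℝ}
    (hQ : IsPosTraceClass (covarianceOperator m) K) {t : ℝ} (ht : 0 < t) :
    gaussianN 0 (covAt (covarianceOperator m) t) ≤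
      ENNReal.ofReal (Real.exp (K / (2 * t))) • m := by
  rw [eq_of_isGaussianWith (isGaussianWith_gaussianN_covAt h0 hQ ht)
    (isGaussianWith_map_rootOp h0 hQ ht)]
  exact map_rootOp_le h0 hQ ht

/-- The Cameron–Martin formula for the shift of `N_{Q_t}` by `r e^{tA} h`. -/
lemma lintegral_gaussianN_comp_add_eq (h0 : ∫ x, x ∂m = 0) {K : ℝ}
    (hQ : IsPosTraceClass (covarianceOperator m) K) {t : ℝ} (ht : 0 < t) (h : H) (r : ℝ)
    {g : H → ℝ≥0∞} (hg : Measurable g) :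
    ∫⁻ y, g (y + r • expA (covarianceOperator m) t h)
        ∂(gaussianN 0 (covAt (covarianceOperator m) t)) =
      ∫⁻ y, g y * ENNReal.ofReal (Real.exp (r * ⟪shiftOp (covarianceOperator m) t h, y⟫_ℝ -
          r ^ 2 * ⟪shiftOp (covarianceOperator m) t h, expA (covarianceOperator m) t h⟫_ℝ / 2))
        ∂(gaussianN 0 (covAt (covarianceOperator m) t)) := by
  obtain ⟨hN1, hN2, hN3⟩ := isGaussianWith_gaussianN_covAt h0 hQ ht
  rw [lintegral_comp_add_eq (z := r • shiftOp (covarianceOperator m) t h) hN2 (fun ξ ↦ ?_) hg]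
  · simp only [real_inner_smul_left, real_inner_smul_right]
    refine lintegral_congr fun y ↦ ?_
    congr 4
    ring
  · rw [covarianceBilin_comm, hN3, map_smul, hQ.covAt_shiftOp ht, real_inner_comm]

/-- The law of `e^{tA} x + y` under `N_{Q_t}` has a density with respect to `m` which is at most
`C e^{⟪z, ·⟫}` with `z = Q_t⁻¹ e^{tA} x`. -/
lemma lintegral_mehler_le (h0 : ∫ x, x ∂m = 0) {K : ℝ}
    (hQ : IsPosTraceClass (covarianceOperator m) K) {t : ℝ} (ht : 0 < t) (x : H)
    {g : H → ℝ≥0∞} (hg : Measurable g) :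
    ∫⁻ y, g (expA (covarianceOperator m) t x + y)
        ∂(gaussianN 0 (covAt (covarianceOperator m) t)) ≤
      ENNReal.ofReal (Real.exp (K / (2 * t))) * ∫⁻ y, g y *
        ENNReal.ofReal (Real.exp ⟪shiftOp (covarianceOperator m) t x, y⟫_ℝ) ∂m := by
  obtain ⟨hN1, hN2, hN3⟩ := isGaussianWith_gaussianN_covAt h0 hQ ht
  have hc : 0 ≤ ⟪shiftOp (covarianceOperator m) t x, expA (covarianceOperator m) t x⟫_ℝ := by
    rw [← hQ.covAt_shiftOp ht x, real_inner_comm, ← hN3]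
    exact covarianceBilin_self_nonneg _
  have h1 := lintegral_gaussianN_comp_add_eq h0 hQ ht x 1 hg
  simp only [one_smul, one_mul, one_pow] at h1
  simp only [add_comm (expA (covarianceOperator m) t x)]
  rw [h1]
  calc _ ≤ ∫⁻ y, g y * ENNReal.ofReal (Real.exp ⟪shiftOp (covarianceOperator m) t x, y⟫_ℝ)
        ∂(gaussianN 0 (covAt (covarianceOperator m) t)) := by
        refine lintegral_mono fun y ↦ ?_
        gcongr
        linarith
    _ ≤ ∫⁻ y, g y * ENNReal.ofReal (Real.exp ⟪shiftOp (covarianceOperator m) t x, y⟫_ℝ)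
        ∂(ENNReal.ofReal (Real.exp (K / (2 * t))) • m) :=
        lintegral_mono' (gaussianN_covAt_le h0 hQ ht) le_rfl
    _ = _ := lintegral_smul_measure ..

lemma quasiMeasurePreserving_mehler (h0 : ∫ x, x ∂m = 0) {K : ℝ}
    (hQ : IsPosTraceClass (covarianceOperator m) K) {t : ℝ} (ht : 0 < t) (x : H) :
    Measure.QuasiMeasurePreserving (fun y ↦ expA (covarianceOperator m) t x + y)
      (gaussianN 0 (covAt (covarianceOperator m) t)) m := by
  refine ⟨by fun_prop, Measure.AbsolutelyContinuous.mk fun A hA hA0 ↦ ?_⟩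
  rw [Measure.map_apply (by fun_prop) hA, ← lintegral_indicator_one
    (measurableSet_preimage (by fun_prop) hA), ← nonpos_iff_eq_zero]
  refine (lintegral_mehler_le h0 hQ ht x (g := A.indicator 1)
    (measurable_one.indicator hA)).trans (le_of_eq ?_)
  rw [lintegral_eq_zero_of_ae_eq_zero, mul_zero]
  have : ∀ᵐ y ∂m, y ∉ A := measure_eq_zero_iff_ae_notMem.1 hA0
  filter_upwards [this] with y hy
  simp [hy]

lemma lintegral_exp_inner_lt_top (h0 : ∫ x, x ∂m = 0) (z : H) :
    ∫⁻ y, ENNReal.ofReal (Real.exp ⟪z, y⟫_ℝ) ∂m < ⊤ := by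
  have h1 := integrable_exp_mul_gaussianReal (μ := 0) (v := (covarianceBilin m z z).toNNReal) 1
  rw [← map_inner_eq_gaussianReal h0 z] at h1
  simp only [one_mul] at h1
  have h2 := h1.comp_measurable (f := fun y ↦ ⟪z, y⟫_ℝ) (by fun_prop)
  exact h2.lintegral_lt_top

/-- Convergence in `L^p(m)` implies convergence in `L^1` of the law of `e^{tA} x + y` under
`N_{Q_t}`, since the density of that law is in `L^q(m)` for every `q < ∞`. -/
lemma exists_lintegral_mehler_le_eLpNorm (h0 : ∫ x, x ∂m = 0) {K : ℝ}
    (hQ : IsPosTraceClass (covarianceOperator m) K) {t : ℝ} (ht : 0 < t) (x : H)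
    {p : ℝ≥0∞} (hp : 1 < p) (hp' : p ≠ ⊤) :
    ∃ C : ℝ≥0∞, C ≠ ⊤ ∧ ∀ g : H → ℝ≥0∞, AEMeasurable g m →
      ∫⁻ y, g (expA (covarianceOperator m) t x + y)
        ∂(gaussianN 0 (covAt (covarianceOperator m) t)) ≤ C * eLpNorm g p m := by
  set z := shiftOp (covarianceOperator m) t x
  have hpr : 1 < p.toReal := by
    rw [← ENNReal.toReal_one]
    exact (ENNReal.toReal_lt_toReal ENNReal.one_ne_top hp').2 hp
  have hpq := Real.HolderConjugate.conjExponent hpr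
  set q := p.toReal.conjExponent
  refine ⟨ENNReal.ofReal (Real.exp (K / (2 * t))) *
    (∫⁻ y, ENNReal.ofReal (Real.exp ⟪z, y⟫_ℝ) ^ q ∂m) ^ (1 / q), ?_, fun g hg ↦ ?_⟩
  · refine ENNReal.mul_ne_top ENNReal.ofReal_ne_top
      (ENNReal.rpow_ne_top_of_nonneg (by have := hpq.symm.pos; positivity) ?_)
    have : ∀ y, ENNReal.ofReal (Real.exp ⟪z, y⟫_ℝ) ^ q =
        ENNReal.ofReal (Real.exp ⟪q • z, y⟫_ℝ) := fun y ↦ by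
      rw [ENNReal.ofReal_rpow_of_pos (Real.exp_pos _), ← Real.exp_mul, real_inner_smul_left,
        mul_comm]
    simp only [this]
    exact (lintegral_exp_inner_lt_top h0 _).ne
  · have hae := (quasiMeasurePreserving_mehler h0 hQ ht x).ae_eq hg.ae_eq_mk
    calc _ = ∫⁻ y, hg.mk g (expA (covarianceOperator m) t x + y)
          ∂(gaussianN 0 (covAt (covarianceOperator m) t)) := lintegral_congr_ae hae
      _ ≤ _ := lintegral_mehler_le h0 hQ ht x hg.measurable_mk
      _ = ENNReal.ofReal (Real.exp (K / (2 * t))) * ∫⁻ y, (g *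
            fun y ↦ ENNReal.ofReal (Real.exp ⟪z, y⟫_ℝ)) y ∂m := by
          congr 1
          refine lintegral_congr_ae ?_
          filter_upwards [hg.ae_eq_mk] with y hy
          simp [hy, z]
      _ ≤ ENNReal.ofReal (Real.exp (K / (2 * t))) * ((∫⁻ y, g y ^ p.toReal ∂m) ^ (1 / p.toReal) *
            (∫⁻ y, ENNReal.ofReal (Real.exp ⟪z, y⟫_ℝ) ^ q ∂m) ^ (1 / q)) := by
          gcongr
          exact ENNReal.lintegral_mul_le_Lp_mul_Lq m hpq hg (by fun_prop)
      _ = _ := by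
          rw [eLpNorm_eq_lintegral_rpow_enorm_toReal (by positivity) hp']
          simp only [enorm_eq_self]
          ring

/-- With `d = a - c / 2` the exponent is `r d + r (1 - r) c / 2`, where `r (1 - r) ≤ 1 / 4` and
`r d ≤ max 0 d`. -/
lemma exp_mul_sub_le {a c r : ℝ} (hc : 0 ≤ c) (hr0 : 0 ≤ r) (hr1 : r ≤ 1) :
    Real.exp (r * a - r ^ 2 * c / 2) ≤ Real.exp (c / 8) * (1 + Real.exp (a - c / 2)) := by
  have h1 : r * a - r ^ 2 * c / 2 ≤ c / 8 + r * (a - c / 2) := by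
    nlinarith [mul_nonneg hc (sq_nonneg (r - 1 / 2))]
  have h2 : Real.exp (r * (a - c / 2)) ≤ 1 + Real.exp (a - c / 2) := by
    rcases le_total 0 (a - c / 2) with h | h
    · have : Real.exp (r * (a - c / 2)) ≤ Real.exp (a - c / 2) :=
        Real.exp_le_exp.2 (mul_le_of_le_one_left h hr1)
      linarith
    · have : Real.exp (r * (a - c / 2)) ≤ 1 :=
        Real.exp_le_one_iff.2 (mul_nonpos_of_nonneg_of_nonpos hr0 h)
      linarith [Real.exp_pos (a - c / 2)]
  calc _ ≤ Real.exp (c / 8 + r * (a - c / 2)) := Real.exp_le_exp.2 h1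
    _ = Real.exp (c / 8) * Real.exp (r * (a - c / 2)) := Real.exp_add _ _
    _ ≤ _ := by gcongr

/-- A Harnack-type inequality on segments. The logarithm of the Mehler kernel is a concave
quadratic function along the segment from `x` to `x + h`, with second derivative bounded by
`‖h‖² / t`. -/
lemma lintegral_mehler_segment_le (h0 : ∫ x, x ∂m = 0) {K : ℝ}
    (hQ : IsPosTraceClass (covarianceOperator m) K) {t : ℝ} (ht : 0 < t) (x h : H) {r : ℝ}
    (hr0 : 0 ≤ r) (hr1 : r ≤ 1) {g : H → ℝ≥0∞} (hg : Measurable g) :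
    ∫⁻ y, g (expA (covarianceOperator m) t x + y + r • expA (covarianceOperator m) t h)
        ∂(gaussianN 0 (covAt (covarianceOperator m) t)) ≤
      ENNReal.ofReal (Real.exp (‖h‖ ^ 2 / (4 * t))) *
        (∫⁻ y, g (expA (covarianceOperator m) t x + y)
            ∂(gaussianN 0 (covAt (covarianceOperator m) t)) +
          ∫⁻ y, g (expA (covarianceOperator m) t (x + h) + y)
            ∂(gaussianN 0 (covAt (covarianceOperator m) t))) := by
  obtain ⟨hN1, hN2, hN3⟩ := isGaussianWith_gaussianN_covAt h0 hQ ht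
  set N := gaussianN 0 (covAt (covarianceOperator m) t)
  set a := expA (covarianceOperator m) t x
  set v := expA (covarianceOperator m) t h with hv
  set z := shiftOp (covarianceOperator m) t h with hz
  have hc : 0 ≤ ⟪z, v⟫_ℝ := by
    rw [hv, ← hQ.covAt_shiftOp ht h, real_inner_comm, ← hN3]
    exact covarianceBilin_self_nonneg _
  have hc' : ⟪z, v⟫_ℝ ≤ ‖h‖ ^ 2 / t := hQ.inner_shiftOp_expA_le ht h
  set c := ⟪z, v⟫_ℝ
  have hg' : Measurable fun y ↦ g (a + y) := by fun_prop
  have e1 := lintegral_gaussianN_comp_add_eq h0 hQ ht h r hg'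
  have e2 := lintegral_gaussianN_comp_add_eq h0 hQ ht h 1 hg'
  simp only [one_smul, one_mul, one_pow] at e2
  have e3 : ∀ y, expA (covarianceOperator m) t (x + h) + y = a + (y + v) := fun y ↦ by
    rw [map_add]; abel
  simp only [e3, add_assoc]
  rw [e1, e2, ← lintegral_add_left hg', ← lintegral_const_mul _ (by fun_prop)]
  refine lintegral_mono fun y ↦ ?_
  have h1 := exp_mul_sub_le (a := ⟪z, y⟫_ℝ) hc hr0 hr1
  have h2 : Real.exp (c / 8) ≤ Real.exp (‖h‖ ^ 2 / (4 * t)) := by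
    refine Real.exp_le_exp.2 ?_
    have h3 : ‖h‖ ^ 2 / (4 * t) = ‖h‖ ^ 2 / t / 4 := by field_simp
    have h4 : 0 ≤ ‖h‖ ^ 2 / t := by positivity
    rw [h3]
    linarith
  calc g (a + y) * ENNReal.ofReal (Real.exp (r * ⟪z, y⟫_ℝ - r ^ 2 * c / 2))
      ≤ g (a + y) * ENNReal.ofReal (Real.exp (‖h‖ ^ 2 / (4 * t)) *
          (1 + Real.exp (⟪z, y⟫_ℝ - c / 2))) := by
        gcongr
        exact h1.trans (by gcongr)
    _ = _ := by
        rw [ENNReal.ofReal_mul (Real.exp_pos _).le,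
          ENNReal.ofReal_add zero_le_one (Real.exp_pos _).le, ENNReal.ofReal_one]
        ring

omit [CompleteSpace H] [SecondCountableTopology H] [MeasurableSpace H] [BorelSpace H] in
lemma IsSmoothCylindrical.contDiff {u : H → ℝ} (hu : IsSmoothCylindrical u) : ContDiff ℝ 1 u := by
  obtain ⟨n, v, φ, hφ, -, hu⟩ := hu
  rw [funext hu]
  exact (hφ.of_le (by exact_mod_cast le_top)).comp
    (contDiff_pi.2 fun i ↦ (innerSL ℝ (v i)).contDiff)

omit [SecondCountableTopology H] [MeasurableSpace H] [BorelSpace H] in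
lemma ContDiff.continuous_gradient {u : H → ℝ} (hu : ContDiff ℝ 1 u) : Continuous (gradient u) :=
  (InnerProductSpace.toDual ℝ H).symm.continuous.comp (hu.continuous_fderiv one_ne_zero)

omit [SecondCountableTopology H] [MeasurableSpace H] [BorelSpace H] in
lemma enorm_sub_le_lintegral_gradient {u : H → ℝ} (hu : ContDiff ℝ 1 u) (w v : H) :
    ‖u (w + v) - u w‖ₑ ≤ ∫⁻ r in Set.Icc (0 : ℝ) 1, ‖gradient u (w + r • v)‖ₑ * ‖v‖ₑ := by
  have hder : ∀ r : ℝ, HasDerivAt (fun r : ℝ ↦ u (w + r • v)) (fderiv ℝ u (w + r • v) v) r := by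
    intro r
    have h1 : HasDerivAt (fun r : ℝ ↦ w + r • v) v r := by
      simpa using ((hasDerivAt_id r).smul_const v).const_add w
    exact ((hu.differentiable one_ne_zero) _).hasFDerivAt.comp_hasDerivAt r h1
  have h2 := enorm_sub_le_lintegral_deriv_of_contDiffOn_Icc (f := fun r : ℝ ↦ u (w + r • v))
    (a := 0) (b := 1) (ContDiff.contDiffOn (by fun_prop)) zero_le_one
  simp only [one_smul, zero_smul, add_zero] at h2
  refine h2.trans (lintegral_mono fun r ↦ ?_)
  rw [(hder r).deriv, ← toDual_gradient]
  refine ((InnerProductSpace.toDual ℝ H (gradient u (w + r • v))).le_opENorm v).trans ?_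
  gcongr
  rw [LinearIsometryEquiv.enorm_map]

/-- The gradient estimate for continuously differentiable functions. -/
lemma lintegral_enorm_sub_mehler_le (h0 : ∫ x, x ∂m = 0) {K : ℝ}
    (hQ : IsPosTraceClass (covarianceOperator m) K) {t : ℝ} (ht : 0 < t) (x h : H) {u : H → ℝ}
    (hu : ContDiff ℝ 1 u) :
    ∫⁻ y, ‖u (expA (covarianceOperator m) t (x + h) + y) -
        u (expA (covarianceOperator m) t x + y)‖ₑ
        ∂(gaussianN 0 (covAt (covarianceOperator m) t)) ≤
      ‖h‖ₑ * ENNReal.ofReal (Real.exp (‖h‖ ^ 2 / (4 * t))) *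
        (∫⁻ y, ‖gradient u (expA (covarianceOperator m) t x + y)‖ₑ
            ∂(gaussianN 0 (covAt (covarianceOperator m) t)) +
          ∫⁻ y, ‖gradient u (expA (covarianceOperator m) t (x + h) + y)‖ₑ
            ∂(gaussianN 0 (covAt (covarianceOperator m) t))) := by
  have hN1 := (isGaussianWith_gaussianN_covAt h0 hQ ht).1
  have hseg := fun (r : ℝ) (hr : r ∈ Set.Icc (0 : ℝ) 1) ↦ lintegral_mehler_segment_le h0 hQ ht x h
    hr.1 hr.2 hu.continuous_gradient.enorm.measurable
  set N := gaussianN 0 (covAt (covarianceOperator m) t)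
  set v := expA (covarianceOperator m) t h
  rw [mul_assoc]
  set R := ENNReal.ofReal (Real.exp (‖h‖ ^ 2 / (4 * t))) *
        (∫⁻ y, ‖gradient u (expA (covarianceOperator m) t x + y)‖ₑ ∂N +
          ∫⁻ y, ‖gradient u (expA (covarianceOperator m) t (x + h) + y)‖ₑ ∂N)
  have hvh : ‖v‖ₑ ≤ ‖h‖ₑ := by
    rw [← ofReal_norm, ← ofReal_norm]
    exact ENNReal.ofReal_le_ofReal (hQ.norm_expA_apply_le ht h)
  have hmeas : Measurable fun q : H × ℝ ↦
      ‖gradient u (expA (covarianceOperator m) t x + q.1 + q.2 • v)‖ₑ :=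
    hu.continuous_gradient.enorm.measurable.comp (by fun_prop)
  clear_value N R
  calc ∫⁻ y, ‖u (expA (covarianceOperator m) t (x + h) + y) -
          u (expA (covarianceOperator m) t x + y)‖ₑ ∂N
      ≤ ∫⁻ y, (∫⁻ r in Set.Icc (0 : ℝ) 1,
          ‖gradient u (expA (covarianceOperator m) t x + y + r • v)‖ₑ * ‖h‖ₑ) ∂N := by
        refine lintegral_mono fun y ↦ ?_
        have h1 := enorm_sub_le_lintegral_gradient hu (expA (covarianceOperator m) t x + y) v
        have h2 : expA (covarianceOperator m) t (x + h) + y =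
            expA (covarianceOperator m) t x + y + v := by rw [map_add]; abel
        rw [h2]
        exact h1.trans (lintegral_mono fun r ↦ by gcongr)
    _ = ∫⁻ r in Set.Icc (0 : ℝ) 1, ∫⁻ y,
          ‖gradient u (expA (covarianceOperator m) t x + y + r • v)‖ₑ * ‖h‖ₑ ∂N :=
        lintegral_lintegral_swap (f := fun y r ↦
          ‖gradient u (expA (covarianceOperator m) t x + y + r • v)‖ₑ * ‖h‖ₑ)
          (hmeas.mul_const _).aemeasurable
    _ ≤ ∫⁻ r in Set.Icc (0 : ℝ) 1, R * ‖h‖ₑ := by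
        refine setLIntegral_mono measurable_const fun r hr ↦ ?_
        have hr' := hmeas.comp (measurable_prodMk_right (y := r))
        simp only [Function.comp_def] at hr'
        rw [lintegral_mul_const _ hr']
        gcongr
        exact hseg r hr
    _ = ‖h‖ₑ * R := by
        rw [setLIntegral_const, Real.volume_Icc, sub_zero, ENNReal.ofReal_one, mul_one, mul_comm]

end Comparison

/-! ### The estimate for Sobolev functions -/

section Sobolev

variable {H : Type*} [NormedAddCommGroup H] [InnerProductSpace ℝ H] [CompleteSpace H]
  [SecondCountableTopology H] [MeasurableSpace H] [BorelSpace H]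
  {m : Measure H} [IsGaussian m]

lemma integrable_mehler (h0 : ∫ x, x ∂m = 0) {K : ℝ}
    (hQ : IsPosTraceClass (covarianceOperator m) K) {t : ℝ} (ht : 0 < t) (x : H)
    {p : ℝ≥0∞} (hp : 1 < p) (hp' : p ≠ ⊤) {E : Type*} [NormedAddCommGroup E] {f : H → E}
    (hf : MemLp f p m) :
    Integrable (fun y ↦ f (expA (covarianceOperator m) t x + y))
      (gaussianN 0 (covAt (covarianceOperator m) t)) := by
  refine ⟨hf.1.comp_quasiMeasurePreserving (quasiMeasurePreserving_mehler h0 hQ ht x), ?_⟩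
  obtain ⟨C, hC, h⟩ := exists_lintegral_mehler_le_eLpNorm h0 hQ ht x hp hp'
  refine (h (fun y ↦ ‖f y‖ₑ) hf.1.enorm).trans_lt ?_
  rw [eLpNorm_enorm]
  exact ENNReal.mul_lt_top hC.lt_top hf.2

/-- The gradient estimate, in the stronger form that bounds the integral of
`|f(e^{tA}(x + h) + y) - f(e^{tA} x + y)|`, passes from smooth cylindrical functions to Sobolev
functions because every term is continuous in the norm of `L^p(m)`. -/
lemma HasSobolevGradient.lintegral_enorm_sub_mehler_le (h0 : ∫ x, x ∂m = 0) {K : ℝ}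
    (hQ : IsPosTraceClass (covarianceOperator m) K) {t : ℝ} (ht : 0 < t) (x h : H)
    {p : ℝ≥0∞} (hp : 1 < p) (hp' : p ≠ ⊤) {f : H → ℝ} {G : H → H}
    (hf : HasSobolevGradient p m f G) :
    ∫⁻ y, ‖f (expA (covarianceOperator m) t (x + h) + y) -
        f (expA (covarianceOperator m) t x + y)‖ₑ
        ∂(gaussianN 0 (covAt (covarianceOperator m) t)) ≤
      ‖h‖ₑ * ENNReal.ofReal (Real.exp (‖h‖ ^ 2 / (4 * t))) *
        (∫⁻ y, ‖G (expA (covarianceOperator m) t x + y)‖ₑ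
            ∂(gaussianN 0 (covAt (covarianceOperator m) t)) +
          ∫⁻ y, ‖G (expA (covarianceOperator m) t (x + h) + y)‖ₑ
            ∂(gaussianN 0 (covAt (covarianceOperator m) t))) := by
  obtain ⟨hfp, hGp, u, hu, hlim, hlimG⟩ := hf
  have hest := fun n ↦ _root_.lintegral_enorm_sub_mehler_le h0 hQ ht x h (hu n).contDiff
  have hcont := fun n ↦ (hu n).contDiff.continuous.measurable
  have hcontG := fun n ↦ (hu n).contDiff.continuous_gradient.measurable
  have hmf := fun x ↦ (integrable_mehler h0 hQ ht x hp hp' hfp).aemeasurable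
  have hmG := fun x ↦ (integrable_mehler h0 hQ ht x hp hp' hGp).aemeasurable
  have hK := fun x ↦ exists_lintegral_mehler_le_eLpNorm h0 hQ ht x hp hp'
  set a := expA (covarianceOperator m) t
  set N := gaussianN 0 (covAt (covarianceOperator m) t)
  -- The errors of approximation tend to zero at every point.
  have herr : ∀ x, Tendsto (fun n ↦ ∫⁻ y, ‖u n (a x + y) - f (a x + y)‖ₑ ∂N) atTop (𝓝 0) := by
    intro x
    obtain ⟨C, hC, hle⟩ := hK x
    have h1 := ENNReal.Tendsto.const_mul hlim (Or.inr hC)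
    rw [mul_zero] at h1
    refine tendsto_of_tendsto_of_tendsto_of_le_of_le tendsto_const_nhds h1
      (fun n ↦ zero_le) fun n ↦ ?_
    have := hle (fun y ↦ ‖u n y - f y‖ₑ) ((hcont n).aemeasurable.sub hfp.1.aemeasurable).enorm
    rwa [eLpNorm_enorm] at this
  have herrG : ∀ x, Tendsto (fun n ↦ ∫⁻ y, ‖gradient (u n) (a x + y) - G (a x + y)‖ₑ ∂N) atTop
      (𝓝 0) := by
    intro x
    obtain ⟨C, hC, hle⟩ := hK x
    have h1 := ENNReal.Tendsto.const_mul hlimG (Or.inr hC)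
    rw [mul_zero] at h1
    refine tendsto_of_tendsto_of_tendsto_of_le_of_le tendsto_const_nhds h1
      (fun n ↦ zero_le) fun n ↦ ?_
    have := hle (fun y ↦ ‖gradient (u n) y - G y‖ₑ)
      ((hcontG n).aemeasurable.sub hGp.1.aemeasurable).enorm
    rwa [eLpNorm_enorm] at this
  set L := ‖h‖ₑ * ENNReal.ofReal (Real.exp (‖h‖ ^ 2 / (4 * t)))
  have hL : L ≠ ⊤ := ENNReal.mul_ne_top enorm_ne_top ENNReal.ofReal_ne_top
  have htri : ∀ n x, ∫⁻ y, ‖gradient (u n) (a x + y)‖ₑ ∂N ≤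
      ∫⁻ y, ‖G (a x + y)‖ₑ ∂N + ∫⁻ y, ‖gradient (u n) (a x + y) - G (a x + y)‖ₑ ∂N := by
    intro n x
    rw [← lintegral_add_left' (hmG x).enorm]
    refine lintegral_mono fun y ↦ ?_
    simpa using! enorm_add_le (G (a x + y)) (gradient (u n) (a x + y) - G (a x + y))
  have hbound : ∀ n, ∫⁻ y, ‖f (a (x + h) + y) - f (a x + y)‖ₑ ∂N ≤
      ∫⁻ y, ‖u n (a (x + h) + y) - f (a (x + h) + y)‖ₑ ∂N +
        ∫⁻ y, ‖u n (a x + y) - f (a x + y)‖ₑ ∂N +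
      L * ((∫⁻ y, ‖G (a x + y)‖ₑ ∂N +
          ∫⁻ y, ‖gradient (u n) (a x + y) - G (a x + y)‖ₑ ∂N) +
        (∫⁻ y, ‖G (a (x + h) + y)‖ₑ ∂N +
          ∫⁻ y, ‖gradient (u n) (a (x + h) + y) - G (a (x + h) + y)‖ₑ ∂N)) := by
    intro n
    refine le_trans ?_ (add_le_add_right ((hest n).trans
      (mul_le_mul_right (add_le_add (htri n x) (htri n (x + h))) _)) _)
    rw [← lintegral_add_left' (by
        exact (((hcont n).comp (by fun_prop)).aemeasurable.sub (hmf (x + h))).enorm),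
      ← lintegral_add_left' (by
        exact (((hcont n).comp (by fun_prop)).aemeasurable.sub (hmf (x + h))).enorm.add
          (((hcont n).comp (by fun_prop)).aemeasurable.sub (hmf x)).enorm)]
    refine lintegral_mono fun y ↦ ?_
    calc ‖f (a (x + h) + y) - f (a x + y)‖ₑ
        = ‖-(u n (a (x + h) + y) - f (a (x + h) + y)) + (u n (a x + y) - f (a x + y)) +
            (u n (a (x + h) + y) - u n (a x + y))‖ₑ := by congr 1; ring
      _ ≤ ‖-(u n (a (x + h) + y) - f (a (x + h) + y))‖ₑ + ‖u n (a x + y) - f (a x + y)‖ₑ +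
            ‖u n (a (x + h) + y) - u n (a x + y)‖ₑ :=
          (enorm_add_le _ _).trans (by gcongr; exact enorm_add_le _ _)
      _ = _ := by rw [enorm_neg]
  have h1 := ((herr (x + h)).add (herr x)).add (ENNReal.Tendsto.const_mul
    (((tendsto_const_nhds (x := ∫⁻ y, ‖G (a x + y)‖ₑ ∂N)).add (herrG x)).add
      ((tendsto_const_nhds (x := ∫⁻ y, ‖G (a (x + h) + y)‖ₑ ∂N)).add (herrG (x + h))))
    (Or.inr hL))
  simp only [add_zero, zero_add] at h1
  exact ge_of_tendsto' h1 hbound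

end Sobolev

theorem mainTheorem6 {H : Type*} [NormedAddCommGroup H] [InnerProductSpace ℝ H] [CompleteSpace H]
    [SecondCountableTopology H] [MeasurableSpace H] [BorelSpace H]
    (m : Measure H) [IsGaussian m]
    (hcentered : ∫ x, x ∂m = 0)
    (hnondeg : ∀ x : H, covarianceOperator m x = 0 → x = 0)
    (p : ℝ≥0∞) (hp : 1 < p) (hp' : p ≠ ⊤)
    (f : H → ℝ) (G : H → H) (hf : HasSobolevGradient p m f G)
    (t : ℝ) (ht : 0 < t) :
    (∀ s : ℝ, 0 < s →
      Summable (fun μ : ℝ => Real.exp (-s / (2 * μ)) • eigenProj (covarianceOperator m) μ)) ∧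
    IsGaussianWith 0 (covAt (covarianceOperator m) t)
      (gaussianN 0 (covAt (covarianceOperator m) t)) ∧
    (∀ x : H,
      Integrable (fun y => f (expA (covarianceOperator m) t x + y))
        (gaussianN 0 (covAt (covarianceOperator m) t)) ∧
      Integrable (fun y => ‖G (expA (covarianceOperator m) t x + y)‖)
        (gaussianN 0 (covAt (covarianceOperator m) t))) ∧
    ∀ x₀ x₁ : H,
      |mehlerP (covarianceOperator m) t f x₀ - mehlerP (covarianceOperator m) t f x₁| ≤
        ‖x₁ - x₀‖ * Real.exp (‖x₁ - x₀‖ ^ 2 / (4 * t)) *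
          (mehlerP (covarianceOperator m) t (fun y => ‖G y‖) x₀ +
            mehlerP (covarianceOperator m) t (fun y => ‖G y‖) x₁) := by
  have hQ := isPosTraceClass_covarianceOperator hnondeg
  have hif := fun x ↦ integrable_mehler hcentered hQ ht x hp hp' hf.1
  have hiG := fun x ↦ integrable_mehler hcentered hQ ht x hp hp' hf.2.1
  refine ⟨fun s hs ↦ hQ.summable_smul_eigenProj (abs_exp_le_mul hs),
    isGaussianWith_gaussianN_covAt hcentered hQ ht, fun x ↦ ⟨hif x, (hiG x).norm⟩,
    fun x₀ x₁ ↦ ?_⟩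
  have hmain := hf.lintegral_enorm_sub_mehler_le hcentered hQ ht x₀ (x₁ - x₀) hp hp'
  rw [add_sub_cancel] at hmain
  rw [abs_sub_comm, ← Real.norm_eq_abs]
  unfold mehlerP
  rw [← integral_sub (hif x₁) (hif x₀)]
  have hnn : ∀ x, 0 ≤ ∫ y, ‖G (expA (covarianceOperator m) t x + y)‖
      ∂(gaussianN 0 (covAt (covarianceOperator m) t)) :=
    fun x ↦ integral_nonneg fun y ↦ norm_nonneg _
  rw [← ENNReal.ofReal_le_ofReal_iff (mul_nonneg (by positivity) (add_nonneg (hnn _) (hnn _))),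
    ofReal_norm, ENNReal.ofReal_mul (by positivity), ENNReal.ofReal_mul (norm_nonneg _),
    ENNReal.ofReal_add (hnn _) (hnn _), ofReal_integral_norm_eq_lintegral_enorm (hiG x₀),
    ofReal_integral_norm_eq_lintegral_enorm (hiG x₁), ofReal_norm]
  exact (enorm_integral_le_lintegral_enorm _).trans hmain
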